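/- Theorem 1.2. Let $\mathbf{k}$ be a field of characteristic $0$, let $V=V_{\bar 0}\oplus V_{\bar 1}$ be a finite-dimensional $\mathbb{Z}/2$-graded $\mathbf{k}$-vector space, and let $G\subseteq GL(V)$ be a finite subgroup under which $V_{\bar 0}$ and $V_{\bar 1}$ are stable. For every such graded space put $$\operatorname{Sym}_\pm V=\operatorname{Sym}(V_{\bar 0})\otimes\wedge(V_{\bar 1}),\qquad (\operatorname{Sym}_\pm V)_{ij}=\operatorname{Sym}^i(V_{\bar 0})\otimes\wedge^j(V_{\bar 1}),\quad (i,j)\in\mathbb{N}^2,\ \mathbb{N}=\{0,1,2,\dots\},$$ on which $G$ acts by algebra automorphisms preserving the bigrading. For a bigraded subspace $U=\bigoplus_{i,j}U_{ij}$ of $\operatorname{Sym}_\pm V$ write $\operatorname{H}(U,q,u)=\sum_{(i,j)\in\mathbb{N}^2}\dim_{\mathbf{k}}(U_{ij})\,q^iu^j\in\mathbb{Z}[[q,u]]$, and let $$a_{ij}=\dim_{\mathbf{k}}\left(\operatorname{Sym}^i(V_{\bar 0})\otimes\wedge^j(V_{\bar 1})\right)^G .$$ For $n\ge 0$ let the wreath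 product $\mathfrak{S}_n[G]=\mathfrak{S}_n\ltimes G^n$ act on $V^n=V_{\bar 0}^n\oplus V_{\bar 1}^n$, where $G^n$ acts coordinatewise and $\mathfrak{S}_n$ permutes the $n$ coordinates, and hence on $\operatorname{Sym}_\pm V^n$. Let $\operatorname{sgn}:\mathfrak{S}_n[G]\twoheadrightarrow\mathfrak{S}_n\to\{\pm1\}$ be the sign character, let $(\operatorname{Sym}_\pm V^n)^{\mathfrak{S}_n[G]}$ be the space of invariants, and let $$(\operatorname{Sym}_\pm V^n)^{\mathfrak{S}_n[G],\operatorname{sgn}}=\{f\in\operatorname{Sym}_\pm V^n: x(f)=\operatorname{sgn}(x)f\ \text{for all } x\in\mathfrak{S}_n[G]\}.$$ Then in $\mathbb{Z}[[t,q,u]]$ $$\sum_{n=0}^\infty t^n\operatorname{H}\left((\operatorname{Sym}_\pm V^n)^{\mathfrak{S}_n[G]},q,u\right)=\prod_{\substack{(i,j)\in\mathbb{N}^2\\ j\text{ odd}}}(1+tq^iu^j)^{a_{ij}}\bigg/\prod_{\substack{(i,j)\in\mathbb{N}^2\\ j\text{ even}}}(1-tq^iu^j)^{a_{ij}},$$ $$\sum_{n=0}^\infty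 t^n\operatorname{H}\left((\operatorname{Sym}_\pm V^n)^{\mathfrak{S}_n[G],\operatorname{sgn}},q,u\right)=\prod_{\substack{(i,j)\in\mathbb{N}^2\\ j\text{ even}}}(1+tq^iu^j)^{a_{ij}}\bigg/\prod_{\substack{(i,j)\in\mathbb{N}^2\\ j\text{ odd}}}(1-tq^iu^j)^{a_{ij}}.$$ -/

import Mathlib

open scoped TensorProduct MvPowerSeries.WithPiTopology

namespace SuperInv

section Algebra

variable {k : Type*} [Field k]
variable {H : Type*} [Group H]
variable {W V₀ V₁ : Type*} [AddCommGroup W] [Module k W]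
  [AddCommGroup V₀] [Module k V₀] [AddCommGroup V₁] [Module k V₁]

/-- A subgroup `G` of `GL(V)` preserves the `ℤ/2`-grading `V = V₀ ⊕ V₁` if both summands are
`G`-stable. -/
def PreservesGrading (V₀ V₁ : Submodule k W) (G : Subgroup (LinearMap.GeneralLinearGroup k W)) :
    Prop :=
  ∀ g ∈ G, (∀ v ∈ V₀, (g : W →ₗ[k] W) v ∈ V₀) ∧ (∀ v ∈ V₁, (g : W →ₗ[k] W) v ∈ V₁)

/-- The restriction to a `G`-stable subspace `U` of the tautological action of `G ≤ GL(W)`. -/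
def restrictRep (G : Subgroup (LinearMap.GeneralLinearGroup k W)) (U : Submodule k W)
    (hU : ∀ g ∈ G, ∀ v ∈ U, (g : W →ₗ[k] W) v ∈ U) : Representation k G U where
  toFun g := ((g : LinearMap.GeneralLinearGroup k W) : W →ₗ[k] W).restrict (hU g.1 g.2)
  map_one' := by ext v; rfl
  map_mul' g h := by ext v; rfl

/-- The action of `G` on the even part `V₀`. -/
def evenRep {V₀ V₁ : Submodule k W} {G : Subgroup (LinearMap.GeneralLinearGroup k W)}
    (hG : PreservesGrading V₀ V₁ G) : Representation k G V₀ :=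
  restrictRep G V₀ (fun g hg => (hG g hg).1)

/-- The action of `G` on the odd part `V₁`. -/
def oddRep {V₀ V₁ : Submodule k W} {G : Subgroup (LinearMap.GeneralLinearGroup k W)}
    (hG : PreservesGrading V₀ V₁ G) : Representation k G V₁ :=
  restrictRep G V₁ (fun g hg => (hG g hg).2)

/-- The algebra map `Sym(V₀) → Sym(W)` induced by a linear map `V₀ → W`. -/
noncomputable def symMap (f : V₀ →ₗ[k] W) : SymmetricAlgebra k V₀ →ₐ[k] SymmetricAlgebra k W :=
  SymmetricAlgebra.lift (SymmetricAlgebra.ι k W ∘ₗ f)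

theorem symMap_id : symMap (LinearMap.id : V₀ →ₗ[k] V₀) = AlgHom.id k _ := by
  apply SymmetricAlgebra.algHom_ext
  ext v
  simp [symMap]

theorem symMap_comp (f g : V₀ →ₗ[k] V₀) : symMap (f ∘ₗ g) = (symMap f).comp (symMap g) := by
  apply SymmetricAlgebra.algHom_ext
  ext v
  simp [symMap]

variable (k V₀ V₁) in
/-- The superpolynomial algebra `Sym(V₀) ⊗ ⋀(V₁)` of the `ℤ/2`-graded space `V₀ ⊕ V₁`. -/
abbrev SuperSym := SymmetricAlgebra k V₀ ⊗[k] ExteriorAlgebra k V₁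

variable (k V₀ V₁) in
/-- The bihomogeneous component `Symⁱ(V₀) ⊗ ⋀ʲ(V₁)` inside `Sym(V₀) ⊗ ⋀(V₁)`; here `Symⁱ(V₀)` is
the `i`-th power of the image of `V₀` in `Sym(V₀)`. -/
noncomputable def superSymPiece (i j : ℕ) : Submodule k (SuperSym k V₀ V₁) :=
  LinearMap.range (TensorProduct.map
    ((LinearMap.range (SymmetricAlgebra.ι k V₀)) ^ i).subtype (⋀[k]^j V₁).subtype)

/-- The action of `H` on `Sym(V₀) ⊗ ⋀(V₁)` by algebra automorphisms, induced by its actions on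
`V₀` and on `V₁`. -/
noncomputable def superSymRep (ρ₀ : Representation k H V₀) (ρ₁ : Representation k H V₁) :
    Representation k H (SuperSym k V₀ V₁) where
  toFun h := (Algebra.TensorProduct.map (symMap (ρ₀ h)) (ExteriorAlgebra.map (ρ₁ h))).toLinearMap
  map_one' := by
    apply TensorProduct.ext'
    intro x y
    have h₀ : symMap (ρ₀ 1) x = x := by
      rw [map_one]; exact DFunLike.congr_fun symMap_id x
    have h₁ : ExteriorAlgebra.map (ρ₁ 1) y = y := by
      rw [map_one]; exact DFunLike.congr_fun ExteriorAlgebra.map_id y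
    rw [AlgHom.toLinearMap_apply, Algebra.TensorProduct.map_tmul, h₀, h₁, Module.End.one_apply]
  map_mul' g h := by
    apply TensorProduct.ext'
    intro x y
    have h₀ : symMap (ρ₀ (g * h)) x = symMap (ρ₀ g) (symMap (ρ₀ h) x) := by
      rw [map_mul]; exact DFunLike.congr_fun (symMap_comp _ _) x
    have h₁ : ExteriorAlgebra.map (ρ₁ (g * h)) y =
        ExteriorAlgebra.map (ρ₁ g) (ExteriorAlgebra.map (ρ₁ h) y) := by
      rw [map_mul]; exact (DFunLike.congr_fun (ExteriorAlgebra.map_comp_map (ρ₁ h) (ρ₁ g)) y).symm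
    rw [Module.End.mul_apply, AlgHom.toLinearMap_apply, AlgHom.toLinearMap_apply,
      AlgHom.toLinearMap_apply, Algebra.TensorProduct.map_tmul, Algebra.TensorProduct.map_tmul,
      Algebra.TensorProduct.map_tmul, h₀, h₁]

/-- The `χ`-relative invariants `{w : h w = χ(h) w for all h}`. -/
def relInvariants (ρ : Representation k H W) (χ : H →* kˣ) : Submodule k W where
  carrier := {w | ∀ h, ρ h w = (χ h : k) • w}
  zero_mem' := by intro h; simp
  add_mem' := by
    intro a b ha hb h
    rw [map_add, ha h, hb h, smul_add]
  smul_mem' := by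
    intro c a ha h
    rw [map_smul, ha h, smul_comm]

/-- The bigraded Hilbert series in `ℤ⟦q, u⟧` of a (bihomogeneous) subspace `U` of
`Sym(V₀) ⊗ ⋀(V₁)`: the coefficient of `qⁱ uʲ` is the dimension of the `(i, j)`-component of `U`.
The variables `0, 1` of `MvPowerSeries (Fin 2) ℤ` are `q, u`. -/
noncomputable def hilb (U : Submodule k (SuperSym k V₀ V₁)) : MvPowerSeries (Fin 2) ℤ :=
  fun m => (Module.finrank k ↥(U ⊓ superSymPiece k V₀ V₁ (m 0) (m 1)) : ℤ)

/-- The wreath product `𝔖ₙ[H] = 𝔖ₙ ⋉ Hⁿ`, with `𝔖ₙ` permuting the coordinates of `Hⁿ`. -/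
abbrev Wreath (n : ℕ) (H : Type*) [Group H] :=
  (Fin n → H) ⋊[(mulAutArrow : Equiv.Perm (Fin n) →* MulAut (Fin n → H))] Equiv.Perm (Fin n)

/-- The action of `𝔖ₙ[H]` on `Wⁿ`: the group `Hⁿ` acts coordinatewise and `𝔖ₙ` permutes the
coordinates. -/
def wreathRep (n : ℕ) (ρ : Representation k H W) : Representation k (Wreath n H) (Fin n → W) where
  toFun x :=
    { toFun := fun v i => ρ (x.left i) (v (x.right⁻¹ i))
      map_add' := by intro v w; ext i; simp
      map_smul' := by intro c v; ext i; simp }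
  map_one' := by ext v i; simp
  map_mul' x y := by
    apply LinearMap.ext
    intro v
    funext i
    change ρ (x.left i * y.left (x.right⁻¹ i)) (v ((x.right * y.right)⁻¹ i)) =
      ρ (x.left i) (ρ (y.left (x.right⁻¹ i)) (v (y.right⁻¹ (x.right⁻¹ i))))
    rw [map_mul, mul_inv_rev]
    rfl

/-- The permutation `σ` sends `(v₁, …, vₙ)` to `(v_{σ⁻¹(1)}, …, v_{σ⁻¹(n)})`. -/
theorem wreathRep_perm (n : ℕ) (ρ : Representation k H W) (σ : Equiv.Perm (Fin n))
    (v : Fin n → W) (i : Fin n) :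
    wreathRep n ρ (SemidirectProduct.inr σ) v i = v (σ⁻¹ i) := by
  change ρ 1 (v (σ⁻¹ i)) = v (σ⁻¹ i)
  rw [map_one]
  rfl

/-- The tuple `(g₁, …, gₙ)` sends `(v₁, …, vₙ)` to `(g₁ v₁, …, gₙ vₙ)`. -/
theorem wreathRep_tuple (n : ℕ) (ρ : Representation k H W) (g : Fin n → H)
    (v : Fin n → W) (i : Fin n) :
    wreathRep n ρ (SemidirectProduct.inl g) v i = ρ (g i) (v i) := rfl

/-- The action of `𝔖ₙ[H]` on the superpolynomial algebra of `V₀ⁿ ⊕ V₁ⁿ = (V₀ ⊕ V₁)ⁿ`. -/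
noncomputable def wreathSuperSymRep (n : ℕ) (ρ₀ : Representation k H V₀)
    (ρ₁ : Representation k H V₁) :
    Representation k (Wreath n H) (SuperSym k (Fin n → V₀) (Fin n → V₁)) :=
  superSymRep (wreathRep n ρ₀) (wreathRep n ρ₁)

/-- The dimension `a_{ij}` of the space of `H`-invariants in `Symⁱ(V₀) ⊗ ⋀ʲ(V₁)`, for
`p = (i, j)`. -/
noncomputable def invDim (ρ₀ : Representation k H V₀) (ρ₁ : Representation k H V₁)
    (p : ℕ × ℕ) : ℕ :=
  Module.finrank k ↥((superSymRep ρ₀ ρ₁).invariants ⊓ superSymPiece k V₀ V₁ p.1 p.2)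

/-- The sign character `𝔖ₙ[H] ↠ 𝔖ₙ → {±1}`, with values in `kˣ`. -/
noncomputable def wreathSign (k : Type*) [Field k] (n : ℕ) (H : Type*) [Group H] :
    Wreath n H →* kˣ :=
  ((Units.map (Int.castRingHom k : ℤ →* k)).comp Equiv.Perm.sign).comp SemidirectProduct.rightHom

end Algebra

section Series

/-- The generating function `∑ₙ tⁿ Fₙ(q, u)` in `ℤ⟦t, q, u⟧` of a sequence of `Fₙ` in `ℤ⟦q, u⟧`:
the coefficient of `tⁿ qⁱ uʲ` is the coefficient of `qⁱ uʲ` in `Fₙ`. The variables `0, 1, 2` of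
`MvPowerSeries (Fin 3) ℤ` are `t, q, u`. -/
noncomputable def genFun (F : ℕ → MvPowerSeries (Fin 2) ℤ) : MvPowerSeries (Fin 3) ℤ :=
  fun m => MvPowerSeries.coeff (Finsupp.single 0 (m 1) + Finsupp.single 1 (m 2)) (F (m 0))

/-- The monomial `t qⁱ uʲ` in `ℤ⟦t, q, u⟧`, for `p = (i, j)`. -/
noncomputable def tqu (p : ℕ × ℕ) : MvPowerSeries (Fin 3) ℤ :=
  MvPowerSeries.X 0 * MvPowerSeries.X 1 ^ p.1 * MvPowerSeries.X 2 ^ p.2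

/-- `F = ∏ₐ num(a) / ∏_b den(b)` in `ℤ⟦t, q, u⟧`: both (possibly infinite) products converge
coefficientwise, the denominator is invertible, and `F` is the quotient. -/
def IsProdQuotient {A B : Type} (F : MvPowerSeries (Fin 3) ℤ) (num : A → MvPowerSeries (Fin 3) ℤ)
    (den : B → MvPowerSeries (Fin 3) ℤ) : Prop :=
  Multipliable num ∧ Multipliable den ∧ IsUnit (∏' b, den b) ∧
    F * (∏' b, den b) = ∏' a, num a

end Series

end SuperInv

/-!
Write `A = Sym(V₀) ⊗ ⋀(V₁)`. The superpolynomial algebra of `V₀ⁿ ⊕ V₁ⁿ` is the `n`-th tensor power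
of `A` in the category of superspaces: the products `ι₁(a₁) ⋯ ιₙ(aₙ)`, where `ιᵢ` is induced by
the inclusion of the `i`-th coordinate, give a basis of it when each `aᵢ` runs over a basis of `A`
(`exists_coordProd_basis`). The group `Gⁿ` acts on such products factor by factor, and `𝔖ₙ`
permutes them up to Koszul signs (`exists_sign_inr_coordProd`); a transposition exchanging two
equal factors of exterior degree `j` acts by `(-1)ʲ` (`swap_coordProd`).

Since the characteristic is zero, `A` has a bihomogeneous basis made of invariants of `G` and of
elements with zero average over `G` (`exists_adapted_basis`). Averaging over `Gⁿ` kills every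
product having a factor of the second kind, so the `Gⁿ`-invariants have as a basis the products of
basis invariants, on which `𝔖ₙ` acts by signed permutations. An orbit of `𝔖ₙ` on these products is
a multiset of `n` basis invariants. For a character `χ` of `𝔖ₙ`, it contributes one dimension to the
`χ`-relative invariants if the stabilizer acts through `χ`, none otherwise
(`finrank_relInvariants_monomial`). The stabilizer being generated by transpositions, the condition
is that no basis invariant whose exterior degree `j` has `(-1)ʲ ≠ χ(transposition)` is repeated:
those with `j` odd for the trivial character, those with `j` even for the sign character.

The coefficients of the generating function therefore count multisets in which certain elements
may not be repeated (`finrank_relInvariants_inf_piece`), and each element of weight `t qⁱ uʲ`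
contributes a factor `1 + t qⁱ uʲ` or `1 / (1 - t qⁱ uʲ)` (`isProdQuotient_of_coeff`).
-/

namespace SuperInv

/-! ### Functoriality of the superpolynomial algebra -/

section Functoriality

variable {k : Type*} [Field k]
variable {V₀ V₁ W₀ W₁ U₀ U₁ : Type*}
  [AddCommGroup V₀] [Module k V₀] [AddCommGroup V₁] [Module k V₁]
  [AddCommGroup W₀] [Module k W₀] [AddCommGroup W₁] [Module k W₁]
  [AddCommGroup U₀] [Module k U₀] [AddCommGroup U₁] [Module k U₁]

theorem symMap_ι (f : V₀ →ₗ[k] W₀) (v : V₀) :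
    symMap f (SymmetricAlgebra.ι k V₀ v) = SymmetricAlgebra.ι k W₀ (f v) := by
  simp [symMap]

theorem symMap_symMap (f : W₀ →ₗ[k] U₀) (g : V₀ →ₗ[k] W₀) (x : SymmetricAlgebra k V₀) :
    symMap f (symMap g x) = symMap (f ∘ₗ g) x := by
  have h : (symMap f).comp (symMap g) = symMap (f ∘ₗ g) := by
    apply SymmetricAlgebra.algHom_ext
    ext v
    simp [symMap]
  exact DFunLike.congr_fun h x

/-- The algebra map `Sym(V₀) ⊗ ⋀(V₁) → Sym(W₀) ⊗ ⋀(W₁)` induced by linear maps `V₀ → W₀` and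
`V₁ → W₁`. -/
noncomputable def superMap (f₀ : V₀ →ₗ[k] W₀) (f₁ : V₁ →ₗ[k] W₁) :
    SuperSym k V₀ V₁ →ₐ[k] SuperSym k W₀ W₁ :=
  Algebra.TensorProduct.map (symMap f₀) (ExteriorAlgebra.map f₁)

@[simp]
theorem superMap_tmul (f₀ : V₀ →ₗ[k] W₀) (f₁ : V₁ →ₗ[k] W₁) (x : SymmetricAlgebra k V₀)
    (y : ExteriorAlgebra k V₁) :
    superMap f₀ f₁ (x ⊗ₜ y) = symMap f₀ x ⊗ₜ ExteriorAlgebra.map f₁ y :=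
  Algebra.TensorProduct.map_tmul _ _ _ _

theorem superMap_superMap (f₀ : W₀ →ₗ[k] U₀) (f₁ : W₁ →ₗ[k] U₁) (g₀ : V₀ →ₗ[k] W₀)
    (g₁ : V₁ →ₗ[k] W₁) (x : SuperSym k V₀ V₁) :
    superMap f₀ f₁ (superMap g₀ g₁ x) = superMap (f₀ ∘ₗ g₀) (f₁ ∘ₗ g₁) x := by
  induction x using TensorProduct.induction_on with
  | zero => simp
  | add x y hx hy => simp [hx, hy]
  | tmul x y =>
    simp only [superMap_tmul, symMap_symMap]
    rw [← ExteriorAlgebra.map_comp_map]; rfl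

theorem superSymRep_apply {H : Type*} [Group H] (ρ₀ : Representation k H V₀)
    (ρ₁ : Representation k H V₁) (h : H) (x : SuperSym k V₀ V₁) :
    superSymRep ρ₀ ρ₁ h x = superMap (ρ₀ h) (ρ₁ h) x := rfl

end Functoriality

/-! ### The bigrading and the Koszul sign rule -/

section Bigrading

variable {k : Type*} [Field k]
variable {V₀ V₁ W₀ W₁ : Type*}
  [AddCommGroup V₀] [Module k V₀] [AddCommGroup V₁] [Module k V₁]
  [AddCommGroup W₀] [Module k W₀] [AddCommGroup W₁] [Module k W₁]

theorem tmul_mem_superSymPiece {i j : ℕ} {x : SymmetricAlgebra k V₀} {y : ExteriorAlgebra k V₁}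
    (hx : x ∈ LinearMap.range (SymmetricAlgebra.ι k V₀) ^ i) (hy : y ∈ ⋀[k]^j V₁) :
    x ⊗ₜ y ∈ superSymPiece k V₀ V₁ i j :=
  ⟨⟨x, hx⟩ ⊗ₜ ⟨y, hy⟩, by simp⟩

/-- To prove a property, closed under addition, of the elements of a bihomogeneous component, it
is enough to treat the pure tensors of homogeneous elements. -/
@[elab_as_elim]
theorem superSymPiece_induction {i j : ℕ} {p : SuperSym k V₀ V₁ → Prop}
    (tmul : ∀ x ∈ LinearMap.range (SymmetricAlgebra.ι k V₀) ^ i, ∀ y ∈ ⋀[k]^j V₁, p (x ⊗ₜ y))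
    (zero : p 0) (add : ∀ a b, p a → p b → p (a + b))
    {a : SuperSym k V₀ V₁} (ha : a ∈ superSymPiece k V₀ V₁ i j) : p a := by
  obtain ⟨z, rfl⟩ := ha
  induction z with
  | zero => simpa using zero
  | add x y hx hy => rw [map_add]; exact add _ _ hx hy
  | tmul x y => simpa using tmul x x.2 y y.2

theorem superMap_mem_superSymPiece (f₀ : V₀ →ₗ[k] W₀) (f₁ : V₁ →ₗ[k] W₁) {i j : ℕ}
    {a : SuperSym k V₀ V₁} (ha : a ∈ superSymPiece k V₀ V₁ i j) :
    superMap f₀ f₁ a ∈ superSymPiece k W₀ W₁ i j := by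
  refine superSymPiece_induction (p := fun a => superMap f₀ f₁ a ∈ superSymPiece k W₀ W₁ i j)
    (fun x hx y hy => ?_) (by simp) (fun a b ha hb => by rw [map_add]; exact add_mem ha hb) ha
  rw [superMap_tmul]
  refine tmul_mem_superSymPiece ?_ ?_
  · have h := Submodule.mem_map_of_mem (f := (symMap f₀).toLinearMap) hx
    rw [Submodule.map_pow] at h
    refine pow_le_pow_left' (b := LinearMap.range (SymmetricAlgebra.ι k W₀)) ?_ i h
    rintro _ ⟨_, ⟨v, rfl⟩, rfl⟩
    exact ⟨f₀ v, by simp [symMap_ι]⟩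
  · have h := Submodule.mem_map_of_mem (f := (ExteriorAlgebra.map f₁).toLinearMap) hy
    rw [Submodule.map_pow] at h
    refine pow_le_pow_left' (b := LinearMap.range (ExteriorAlgebra.ι k (M := W₁))) ?_ j h
    rintro _ ⟨_, ⟨v, rfl⟩, rfl⟩
    exact ⟨f₁ v, by simp⟩

theorem one_mem_superSymPiece : (1 : SuperSym k V₀ V₁) ∈ superSymPiece k V₀ V₁ 0 0 :=
  tmul_mem_superSymPiece (by simp) (by simp)

theorem mul_mem_superSymPiece {i j i' j' : ℕ} {a b : SuperSym k V₀ V₁}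
    (ha : a ∈ superSymPiece k V₀ V₁ i j) (hb : b ∈ superSymPiece k V₀ V₁ i' j') :
    a * b ∈ superSymPiece k V₀ V₁ (i + i') (j + j') := by
  refine superSymPiece_induction
    (p := fun a => a * b ∈ superSymPiece k V₀ V₁ (i + i') (j + j')) (fun x hx y hy => ?_) (by simp)
    (fun a b ha hb => by rw [add_mul]; exact add_mem ha hb) ha
  refine superSymPiece_induction
    (p := fun b => x ⊗ₜ y * b ∈ superSymPiece k V₀ V₁ (i + i') (j + j'))
    (fun x' hx' y' hy' => ?_) (by simp)
    (fun a b ha hb => by rw [mul_add]; exact add_mem ha hb) hb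
  rw [Algebra.TensorProduct.tmul_mul_tmul]
  refine tmul_mem_superSymPiece ?_ ?_
  · rw [pow_add]; exact Submodule.mul_mem_mul hx hx'
  · change _ ∈ _ ^ _
    rw [pow_add]; exact Submodule.mul_mem_mul hy hy'

/-- Homogeneous elements of the exterior algebra commute up to the Koszul sign. -/
theorem exterior_mul_comm {i j : ℕ} {x y : ExteriorAlgebra k V₁}
    (hx : x ∈ ⋀[k]^i V₁) (hy : y ∈ ⋀[k]^j V₁) : x * y = (-1 : k) ^ (i * j) • (y * x) := by
  have key : ∀ v : V₁, ∀ {j : ℕ} {y : ExteriorAlgebra k V₁}, y ∈ ⋀[k]^j V₁ →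
      ExteriorAlgebra.ι k v * y = (-1 : k) ^ j • (y * ExteriorAlgebra.ι k v) := by
    intro v j y hy
    induction hy using Submodule.pow_induction_on_left' with
    | algebraMap r => simp [Algebra.commutes]
    | add a b n _ _ ha hb => rw [mul_add, add_mul, smul_add, ha, hb]
    | mem_mul m hm n a _ ih =>
      obtain ⟨w, rfl⟩ := hm
      rw [← mul_assoc, eq_neg_of_add_eq_zero_left (ExteriorAlgebra.ι_add_mul_swap v w), neg_mul,
        mul_assoc, ih, mul_smul_comm, pow_succ, mul_neg_one, neg_smul, mul_assoc]
  induction hx using Submodule.pow_induction_on_left' with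
  | algebraMap r => simp [Algebra.commutes]
  | add a b n _ _ ha hb => rw [mul_add, add_mul, smul_add, ha, hb]
  | mem_mul m hm n a _ ih =>
    obtain ⟨w, rfl⟩ := hm
    rw [mul_assoc, ih, mul_smul_comm, ← mul_assoc, key w hy, smul_mul_assoc, smul_smul, mul_assoc,
      ← pow_add, ← Nat.succ_mul]

/-- Bihomogeneous elements commute up to the Koszul sign of their exterior degrees. -/
theorem superSym_mul_comm {i j i' j' : ℕ} {a b : SuperSym k V₀ V₁}
    (ha : a ∈ superSymPiece k V₀ V₁ i j) (hb : b ∈ superSymPiece k V₀ V₁ i' j') :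
    a * b = (-1 : k) ^ (j * j') • (b * a) := by
  refine superSymPiece_induction (p := fun a => a * b = (-1 : k) ^ (j * j') • (b * a))
    (fun x hx y hy => ?_) (by simp)
    (fun a b ha hb => by rw [mul_add, add_mul, smul_add, ha, hb]) ha
  refine superSymPiece_induction
    (p := fun b => x ⊗ₜ y * b = (-1 : k) ^ (j * j') • (b * x ⊗ₜ y)) (fun x' hx' y' hy' => ?_)
    (by simp) (fun a b ha hb => by rw [mul_add, add_mul, smul_add, ha, hb]) hb
  rw [Algebra.TensorProduct.tmul_mul_tmul, Algebra.TensorProduct.tmul_mul_tmul,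
    exterior_mul_comm hy hy', TensorProduct.tmul_smul, mul_comm x x']

variable (k V₀) in
/-- The algebra map `Sym(V₀) → Sym(V₀)[X]` with `v ↦ v X` for `v ∈ V₀`; it sends an element `x` of
degree `i` to `x Xⁱ`. -/
noncomputable def symDegreeMap : SymmetricAlgebra k V₀ →ₐ[k] Polynomial (SymmetricAlgebra k V₀) :=
  SymmetricAlgebra.lift
    ((LinearMap.mulRight k (Polynomial.X : Polynomial (SymmetricAlgebra k V₀))) ∘ₗ
      (Polynomial.CAlgHom (R := k)).toLinearMap ∘ₗ SymmetricAlgebra.ι k V₀)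

theorem symDegreeMap_of_mem {i : ℕ} {x : SymmetricAlgebra k V₀}
    (hx : x ∈ LinearMap.range (SymmetricAlgebra.ι k V₀) ^ i) :
    symDegreeMap k V₀ x = Polynomial.C x * Polynomial.X ^ i := by
  induction hx using Submodule.pow_induction_on_left' with
  | algebraMap r =>
    rw [AlgHom.commutes, pow_zero, mul_one]; rfl
  | add a b n _ _ ha hb => rw [map_add, ha, hb, map_add, add_mul]
  | mem_mul m hm n a _ ih =>
    obtain ⟨w, rfl⟩ := hm
    rw [map_mul, ih, symDegreeMap, SymmetricAlgebra.lift_ι_apply]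
    simp only [LinearMap.comp_apply, LinearMap.mulRight_apply, AlgHom.toLinearMap_apply,
      Polynomial.CAlgHom_apply, map_mul, pow_succ]
    ring

variable (k V₀ V₁) in
/-- The projection of `Sym(V₀) ⊗ ⋀(V₁)` onto its component of bidegree `(i, j)`. -/
noncomputable def superProj (i j : ℕ) : SuperSym k V₀ V₁ →ₗ[k] SuperSym k V₀ V₁ :=
  TensorProduct.map
    (((Polynomial.lcoeff (SymmetricAlgebra k V₀) i).restrictScalars k) ∘ₗ
      (symDegreeMap k V₀).toLinearMap)
    (GradedAlgebra.proj (fun n : ℕ => ⋀[k]^n V₁) j)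

theorem superProj_of_mem {i j : ℕ} {a : SuperSym k V₀ V₁}
    (ha : a ∈ superSymPiece k V₀ V₁ i j) : superProj k V₀ V₁ i j a = a := by
  refine superSymPiece_induction (p := fun a => superProj k V₀ V₁ i j a = a)
    (fun x hx y hy => ?_) (by simp) (fun a b ha hb => by rw [map_add, ha, hb]) ha
  simp only [superProj, TensorProduct.map_tmul, LinearMap.comp_apply, AlgHom.toLinearMap_apply,
    symDegreeMap_of_mem hx, GradedAlgebra.proj_apply]
  rw [DirectSum.decompose_of_mem_same (fun n : ℕ => ⋀[k]^n V₁) hy]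
  simp

theorem superProj_of_mem_of_ne {i j i' j' : ℕ} (h : (i, j) ≠ (i', j')) {a : SuperSym k V₀ V₁}
    (ha : a ∈ superSymPiece k V₀ V₁ i j) : superProj k V₀ V₁ i' j' a = 0 := by
  refine superSymPiece_induction (p := fun a => superProj k V₀ V₁ i' j' a = 0)
    (fun x hx y hy => ?_) (by simp) (fun a b ha hb => by rw [map_add, ha, hb, add_zero]) ha
  simp only [superProj, TensorProduct.map_tmul, LinearMap.comp_apply, AlgHom.toLinearMap_apply,
    symDegreeMap_of_mem hx, GradedAlgebra.proj_apply]
  by_cases hj : j = j'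
  · have hi : i' ≠ i := by rintro rfl; exact h (by rw [hj])
    simp [Polynomial.coeff_X_pow, hi]
  · rw [DirectSum.decompose_of_mem_ne (fun n : ℕ => ⋀[k]^n V₁) hy hj]
    simp

theorem superSymPiece_iSup :
    ⨆ p : ℕ × ℕ, superSymPiece k V₀ V₁ p.1 p.2 = ⊤ := by
  rw [eq_top_iff]
  rintro a -
  have hS : ∀ x : SymmetricAlgebra k V₀,
      x ∈ ⨆ i : ℕ, LinearMap.range (SymmetricAlgebra.ι k V₀) ^ i := by
    intro x
    induction x using SymmetricAlgebra.induction with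
    | algebraMap r => exact Submodule.mem_iSup_of_mem 0 (by simp)
    | ι v => exact Submodule.mem_iSup_of_mem 1 (by simp)
    | mul a b ha hb =>
      have h := Submodule.mul_mem_mul ha hb
      simp only [Submodule.iSup_mul, Submodule.mul_iSup, ← pow_add] at h
      exact (iSup_le fun i => iSup_le fun j =>
        le_iSup (fun n => LinearMap.range (SymmetricAlgebra.ι k V₀) ^ n) _ :
          (⨆ i, ⨆ j, LinearMap.range (SymmetricAlgebra.ι k V₀) ^ (j + i)) ≤ _) h
    | add a b ha hb => exact add_mem ha hb
  have hE : ∀ y : ExteriorAlgebra k V₁, y ∈ ⨆ i : ℕ, ⋀[k]^i V₁ := fun y => by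
    rw [(DirectSum.Decomposition.isInternal
      (fun n : ℕ => ⋀[k]^n V₁)).submodule_iSup_eq_top]; trivial
  induction a using TensorProduct.induction_on with
  | zero => exact zero_mem _
  | add a b ha hb => exact add_mem ha hb
  | tmul x y =>
    have hx := hS x
    induction hx using Submodule.iSup_induction' with
    | zero => simp
    | add a b _ _ ha hb => rw [TensorProduct.add_tmul]; exact add_mem ha hb
    | mem i x hx =>
      have hy := hE y
      induction hy using Submodule.iSup_induction' with
      | zero => simp
      | add a b _ _ ha hb => rw [TensorProduct.tmul_add]; exact add_mem ha hb
      | mem j y hy =>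
        exact Submodule.mem_iSup_of_mem (p := fun p : ℕ × ℕ => superSymPiece k V₀ V₁ p.1 p.2)
          (i, j) (tmul_mem_superSymPiece hx hy)

theorem superSymPiece_isInternal :
    DirectSum.IsInternal fun p : ℕ × ℕ => superSymPiece k V₀ V₁ p.1 p.2 := by
  refine DirectSum.isInternal_submodule_of_iSupIndep_of_iSup_eq_top ?_ superSymPiece_iSup
  rw [iSupIndep_def]
  intro p
  rw [Submodule.disjoint_def]
  intro a ha ha'
  rw [← superProj_of_mem ha]
  have : (⨆ q, ⨆ (_ : q ≠ p), superSymPiece k V₀ V₁ q.1 q.2) ≤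
      LinearMap.ker (superProj k V₀ V₁ p.1 p.2) :=
    iSup₂_le fun q hq b hb => superProj_of_mem_of_ne hq hb
  exact this ha'

instance finiteDimensional_superSymPiece [FiniteDimensional k V₀] [FiniteDimensional k V₁]
    (i j : ℕ) : FiniteDimensional k (superSymPiece k V₀ V₁ i j) := by
  have h₀ : (LinearMap.range (SymmetricAlgebra.ι k V₀) ^ i).FG :=
    Submodule.FG.pow (Module.Finite.iff_fg.mp inferInstance) i
  have := Module.Finite.iff_fg.mpr h₀
  unfold superSymPiece
  infer_instance

end Bigrading

/-! ### Superpolynomial algebras of direct sums -/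

section DirectSums

variable {k : Type*} [Field k]
variable {M N P : Type*} [AddCommGroup M] [Module k M] [AddCommGroup N] [Module k N]
  [AddCommGroup P] [Module k P]

/-- `Sym(M) ⊗ Sym(N) ≃ Sym(P)` when `P ≃ M × N`. -/
noncomputable def symProdEquiv (e : (M × N) ≃ₗ[k] P) :
    SymmetricAlgebra k M ⊗[k] SymmetricAlgebra k N ≃ₐ[k] SymmetricAlgebra k P :=
  AlgEquiv.ofAlgHom
    (Algebra.TensorProduct.lift (symMap (e.toLinearMap ∘ₗ LinearMap.inl k M N))
      (symMap (e.toLinearMap ∘ₗ LinearMap.inr k M N)) fun _ _ => Commute.all _ _)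
    (SymmetricAlgebra.lift
      ((LinearMap.coprod
        (Algebra.TensorProduct.includeLeft.toLinearMap ∘ₗ SymmetricAlgebra.ι k M)
        (Algebra.TensorProduct.includeRight.toLinearMap ∘ₗ SymmetricAlgebra.ι k N)) ∘ₗ
          e.symm.toLinearMap))
    (by
      apply SymmetricAlgebra.algHom_ext
      ext v
      change Algebra.TensorProduct.lift _ _ (fun _ _ => Commute.all _ _)
        (SymmetricAlgebra.lift _ (SymmetricAlgebra.ι k P v)) =
        SymmetricAlgebra.ι k P v
      rw [SymmetricAlgebra.lift_ι_apply]
      obtain ⟨m, rfl⟩ := e.surjective v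
      simp only [LinearMap.comp_apply, LinearEquiv.coe_coe, LinearEquiv.symm_apply_apply,
        LinearMap.coprod_apply, map_add, AlgHom.toLinearMap_apply,
        Algebra.TensorProduct.includeLeft_apply, Algebra.TensorProduct.includeRight_apply,
        Algebra.TensorProduct.lift_tmul, symMap_ι, map_one, mul_one, one_mul, LinearMap.inl_apply,
        LinearMap.inr_apply]
      rw [← map_add, ← map_add, Prod.mk_add_mk, add_zero, zero_add])
    (by
      apply Algebra.TensorProduct.ext
      · apply SymmetricAlgebra.algHom_ext
        ext v
        simp [symMap_ι]
      · apply SymmetricAlgebra.algHom_ext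
        ext v
        simp [symMap_ι])

/-- An exterior algebra is the Clifford algebra of the zero quadratic form, and the graded tensor
product has the same underlying space as the ordinary one. -/
theorem exists_exteriorProdEquiv (e : (M × N) ≃ₗ[k] P) :
    ∃ f : ExteriorAlgebra k M ⊗[k] ExteriorAlgebra k N ≃ₗ[k] ExteriorAlgebra k P,
      ∀ x y, f (x ⊗ₜ y) = ExteriorAlgebra.map (e.toLinearMap ∘ₗ LinearMap.inl k M N) x *
        ExteriorAlgebra.map (e.toLinearMap ∘ₗ LinearMap.inr k M N) y := by
  let Q₁ : QuadraticForm k M := 0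
  let Q₂ : QuadraticForm k N := 0
  let Q : QuadraticForm k P := 0
  let i : (Q₁.prod Q₂).IsometryEquiv Q := { e with map_app' := fun m => by simp [Q₁, Q₂, Q] }
  refine ⟨(GradedTensorProduct.of k (CliffordAlgebra.evenOdd Q₁) (CliffordAlgebra.evenOdd Q₂)).trans
    ((CliffordAlgebra.prodEquiv Q₁ Q₂).symm.trans
      (CliffordAlgebra.equivOfIsometry i)).toLinearEquiv, fun x y => ?_⟩
  change CliffordAlgebra.map i.toIsometry (CliffordAlgebra.toProd Q₁ Q₂ (x ᵍ⊗ₜ y)) = _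
  rw [CliffordAlgebra.toProd, GradedTensorProduct.lift_tmul, map_mul, ← AlgHom.comp_apply,
    ← AlgHom.comp_apply, CliffordAlgebra.map_comp_map, CliffordAlgebra.map_comp_map]
  rfl

variable {M₁ N₁ P₁ : Type*} [AddCommGroup M₁] [Module k M₁] [AddCommGroup N₁] [Module k N₁]
  [AddCommGroup P₁] [Module k P₁]

/-- The superpolynomial algebra of a direct sum is, as a vector space, the tensor product of the
superpolynomial algebras of the summands. -/
theorem exists_superProdEquiv (e₀ : (M × N) ≃ₗ[k] P) (e₁ : (M₁ × N₁) ≃ₗ[k] P₁) :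
    ∃ f : SuperSym k M M₁ ⊗[k] SuperSym k N N₁ ≃ₗ[k] SuperSym k P P₁,
      ∀ a b, f (a ⊗ₜ b) =
        superMap (e₀.toLinearMap ∘ₗ LinearMap.inl k M N)
          (e₁.toLinearMap ∘ₗ LinearMap.inl k M₁ N₁) a *
        superMap (e₀.toLinearMap ∘ₗ LinearMap.inr k M N)
          (e₁.toLinearMap ∘ₗ LinearMap.inr k M₁ N₁) b := by
  obtain ⟨f, hf⟩ := exists_exteriorProdEquiv e₁
  refine ⟨(TensorProduct.tensorTensorTensorComm k _ _ _ _).trans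
    (TensorProduct.congr (symProdEquiv e₀).toLinearEquiv f), fun a b => ?_⟩
  induction a using TensorProduct.induction_on with
  | zero => simp
  | add a a' ha ha' => simp only [TensorProduct.add_tmul, map_add, add_mul, ha, ha']
  | tmul x y =>
    induction b using TensorProduct.induction_on with
    | zero => simp
    | add b b' hb hb' => simp only [TensorProduct.tmul_add, map_add, mul_add, hb, hb']
    | tmul x' y' =>
      simp only [LinearEquiv.trans_apply, TensorProduct.tensorTensorTensorComm_tmul,
        TensorProduct.congr_tmul, superMap_tmul, Algebra.TensorProduct.tmul_mul_tmul, hf]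
      congr 1

end DirectSums

/-! ### The superpolynomial algebra of a power as a tensor power -/

section Coordinates

variable {k : Type*} [Field k]
variable {V₀ V₁ : Type*} [AddCommGroup V₀] [Module k V₀] [AddCommGroup V₁] [Module k V₁]

variable (k V₀ V₁) in
/-- The algebra map `Sym(V₀) ⊗ ⋀(V₁) → Sym(V₀ⁿ) ⊗ ⋀(V₁ⁿ)` induced by the inclusion of the `i`-th
coordinate. -/
noncomputable def coordMap {n : ℕ} (i : Fin n) :
    SuperSym k V₀ V₁ →ₐ[k] SuperSym k (Fin n → V₀) (Fin n → V₁) :=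
  superMap (LinearMap.single k (fun _ => V₀) i) (LinearMap.single k (fun _ => V₁) i)

variable (k V₀ V₁) in
/-- The multilinear map sending `(a₁, …, aₙ)` to the product, in this order, of the copies of `aᵢ`
in the `i`-th coordinate. It exhibits `Sym(V₀ⁿ) ⊗ ⋀(V₁ⁿ)` as the `n`-th tensor power of
`Sym(V₀) ⊗ ⋀(V₁)`. -/
noncomputable def coordProd (n : ℕ) :
    MultilinearMap k (fun _ : Fin n => SuperSym k V₀ V₁)
      (SuperSym k (Fin n → V₀) (Fin n → V₁)) :=
  (MultilinearMap.mkPiAlgebraFin k n _).compLinearMap fun i => (coordMap k V₀ V₁ i).toLinearMap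

theorem coordProd_apply (n : ℕ) (a : Fin n → SuperSym k V₀ V₁) :
    coordProd k V₀ V₁ n a = (List.ofFn fun i => coordMap k V₀ V₁ i (a i)).prod := by
  simp [coordProd, MultilinearMap.mkPiAlgebraFin_apply]

theorem span_one_of_subsingleton [Subsingleton V₀] [Subsingleton V₁] :
    Submodule.span k {(1 : SuperSym k V₀ V₁)} = ⊤ := by
  rw [eq_top_iff]
  rintro a -
  have hS : ∀ x : SymmetricAlgebra k V₀, ∃ r : k, algebraMap k _ r = x := by
    intro x
    induction x using SymmetricAlgebra.induction with
    | algebraMap r => exact ⟨r, rfl⟩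
    | ι v => exact ⟨0, by rw [Subsingleton.elim v 0]; simp⟩
    | mul a b ha hb =>
      obtain ⟨r, rfl⟩ := ha
      obtain ⟨s, rfl⟩ := hb
      exact ⟨r * s, map_mul _ _ _⟩
    | add a b ha hb =>
      obtain ⟨r, rfl⟩ := ha
      obtain ⟨s, rfl⟩ := hb
      exact ⟨r + s, map_add _ _ _⟩
  have hE : ∀ y : ExteriorAlgebra k V₁, ∃ r : k, algebraMap k _ r = y := by
    intro y
    induction y using ExteriorAlgebra.induction with
    | algebraMap r => exact ⟨r, rfl⟩
    | ι v => exact ⟨0, by rw [Subsingleton.elim v 0]; simp⟩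
    | mul a b ha hb =>
      obtain ⟨r, rfl⟩ := ha
      obtain ⟨s, rfl⟩ := hb
      exact ⟨r * s, map_mul _ _ _⟩
    | add a b ha hb =>
      obtain ⟨r, rfl⟩ := ha
      obtain ⟨s, rfl⟩ := hb
      exact ⟨r + s, map_add _ _ _⟩
  induction a using TensorProduct.induction_on with
  | zero => exact zero_mem _
  | add a b ha hb => exact add_mem ha hb
  | tmul x y =>
    obtain ⟨r, rfl⟩ := hS x
    obtain ⟨s, rfl⟩ := hE y
    rw [Algebra.algebraMap_eq_smul_one, Algebra.algebraMap_eq_smul_one,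
      TensorProduct.smul_tmul_smul]
    exact Submodule.smul_mem _ _ (Submodule.mem_span_singleton_self _)

instance nontrivial_superSym : Nontrivial (SuperSym k V₀ V₁) :=
  (Algebra.TensorProduct.lift (SymmetricAlgebra.algebraMapInv (R := k) (M := V₀))
    (ExteriorAlgebra.algebraMapInv (R := k) (M := V₁))
    fun _ _ => Commute.all _ _).toRingHom.domain_nontrivial

/-- A basis of `Sym(V₀) ⊗ ⋀(V₁)` gives a basis of `Sym(V₀ⁿ) ⊗ ⋀(V₁ⁿ)` made of products. -/
theorem exists_coordProd_basis {S : Type*} (e : Module.Basis S k (SuperSym k V₀ V₁)) (n : ℕ) :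
    ∃ E : Module.Basis (Fin n → S) k (SuperSym k (Fin n → V₀) (Fin n → V₁)),
      ∀ s, E s = coordProd k V₀ V₁ n fun i => e (s i) := by
  induction n with
  | zero =>
    refine ⟨Module.Basis.mk (v := fun _ => 1) ?_ ?_, fun s => ?_⟩
    · rw [linearIndependent_unique_iff]
      exact one_ne_zero
    · rw [Set.range_const, span_one_of_subsingleton]
    · rw [Module.Basis.mk_apply, coordProd_apply]
      simp
  | succ n ih =>
    obtain ⟨E, hE⟩ := ih
    obtain ⟨f, hf⟩ := exists_superProdEquiv (Fin.consLinearEquiv k fun _ : Fin (n + 1) => V₀)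
      (Fin.consLinearEquiv k fun _ : Fin (n + 1) => V₁)
    refine ⟨((e.tensorProduct E).map f).reindex (Fin.consEquiv fun _ => S), fun s => ?_⟩
    rw [Module.Basis.reindex_apply, Module.Basis.map_apply, Module.Basis.tensorProduct_apply, hf,
      hE, coordProd_apply, coordProd_apply, List.ofFn_succ, List.prod_cons, map_list_prod,
      List.map_ofFn]
    congr 1
    · change superMap _ _ (e (s 0)) = superMap _ _ (e (s 0))
      congr 2
      all_goals
        ext v i
        refine Fin.cases ?_ (fun i => ?_) i <;> simp
    · congr 2
      funext i
      change superMap _ _ (superMap _ _ (e (s i.succ))) = superMap _ _ (e (s i.succ))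
      rw [superMap_superMap]
      congr 2
      all_goals
        ext v j
        refine Fin.cases ?_ (fun j => ?_) j
        · simp
        · simp [Pi.single_apply, Fin.succ_inj]

end Coordinates

/-! ### The action of the wreath product on products -/

section WreathAction

variable {k : Type*} [Field k] {H : Type*} [Group H]
variable {V₀ V₁ : Type*} [AddCommGroup V₀] [Module k V₀] [AddCommGroup V₁] [Module k V₁]

theorem wreathRep_comp_single {W : Type*} [AddCommGroup W] [Module k W] {n : ℕ}
    (ρ : Representation k H W) (x : Wreath n H) (i : Fin n) :
    wreathRep n ρ x ∘ₗ LinearMap.single k (fun _ => W) i =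
      LinearMap.single k (fun _ => W) (x.right i) ∘ₗ ρ (x.left (x.right i)) := by
  ext w l
  change ρ (x.left l) ((Pi.single i w : Fin n → W) (x.right⁻¹ l)) =
    (Pi.single (x.right i) (ρ (x.left (x.right i)) w) : Fin n → W) l
  by_cases h : l = x.right i
  · subst h
    simp
  · have h' : x.right⁻¹ l ≠ i := by
      rintro rfl
      simp at h
    rw [Pi.single_eq_of_ne h, Pi.single_eq_of_ne h', map_zero]

variable (ρ₀ : Representation k H V₀) (ρ₁ : Representation k H V₁)

theorem wreathSuperSymRep_coordMap {n : ℕ} (x : Wreath n H) (i : Fin n) (a : SuperSym k V₀ V₁) :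
    wreathSuperSymRep n ρ₀ ρ₁ x (coordMap k V₀ V₁ i a) =
      coordMap k V₀ V₁ (x.right i) (superSymRep ρ₀ ρ₁ (x.left (x.right i)) a) := by
  rw [wreathSuperSymRep, superSymRep_apply, superSymRep_apply, coordMap, coordMap,
    superMap_superMap, superMap_superMap, wreathRep_comp_single, wreathRep_comp_single]

theorem wreathSuperSymRep_coordProd {n : ℕ} (x : Wreath n H) (a : Fin n → SuperSym k V₀ V₁) :
    wreathSuperSymRep n ρ₀ ρ₁ x (coordProd k V₀ V₁ n a) =
      (List.ofFn fun i => coordMap k V₀ V₁ (x.right i)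
        (superSymRep ρ₀ ρ₁ (x.left (x.right i)) (a i))).prod := by
  simp_rw [← wreathSuperSymRep_coordMap]
  rw [coordProd_apply, wreathSuperSymRep, superSymRep_apply, map_list_prod, List.map_ofFn]
  rfl

theorem wreathSuperSymRep_inl_coordProd {n : ℕ} (g : Fin n → H) (a : Fin n → SuperSym k V₀ V₁) :
    wreathSuperSymRep n ρ₀ ρ₁ (SemidirectProduct.inl g) (coordProd k V₀ V₁ n a) =
      coordProd k V₀ V₁ n fun i => superSymRep ρ₀ ρ₁ (g i) (a i) := by
  rw [wreathSuperSymRep_coordProd, coordProd_apply]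
  rfl

theorem wreathSuperSymRep_inr_coordProd {n : ℕ} (σ : Equiv.Perm (Fin n))
    (a : Fin n → SuperSym k V₀ V₁) :
    wreathSuperSymRep n ρ₀ ρ₁ (SemidirectProduct.inr σ) (coordProd k V₀ V₁ n a) =
      (List.ofFn fun i => coordMap k V₀ V₁ (σ i) (a i)).prod := by
  rw [wreathSuperSymRep_coordProd]
  congr 2
  funext i
  change coordMap k V₀ V₁ (σ i) (superSymRep ρ₀ ρ₁ 1 (a i)) = _
  rw [map_one]
  rfl

/-- The sum over `Hⁿ` acts on products factor by factor. -/
theorem sum_inl_coordProd [Fintype H] {n : ℕ} (a : Fin n → SuperSym k V₀ V₁) :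
    ∑ g : Fin n → H, wreathSuperSymRep n ρ₀ ρ₁ (SemidirectProduct.inl g) (coordProd k V₀ V₁ n a) =
      coordProd k V₀ V₁ n fun i => ∑ h, superSymRep ρ₀ ρ₁ h (a i) := by
  classical
  simp_rw [wreathSuperSymRep_inl_coordProd]
  exact ((coordProd k V₀ V₁ n).map_sum fun i h => superSymRep ρ₀ ρ₁ h (a i)).symm

/-- Reordering a product of bihomogeneous elements changes it at most by a sign. -/
theorem exists_sign_of_perm {l l' : List (SuperSym k V₀ V₁)} (h : l.Perm l')
    (hl : ∀ x ∈ l, ∃ i j, x ∈ superSymPiece k V₀ V₁ i j) :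
    ∃ ε : k, ε ≠ 0 ∧ l.prod = ε • l'.prod := by
  induction h with
  | nil => exact ⟨1, one_ne_zero, by simp⟩
  | cons x _ ih =>
    obtain ⟨ε, h0, h⟩ := ih fun y hy => hl y (by simp [hy])
    exact ⟨ε, h0, by rw [List.prod_cons, List.prod_cons, h, mul_smul_comm]⟩
  | swap x y l =>
    obtain ⟨i, j, hx⟩ := hl x (by simp)
    obtain ⟨i', j', hy⟩ := hl y (by simp)
    refine ⟨(-1) ^ (j' * j), by simp, ?_⟩
    simp only [List.prod_cons]
    rw [← mul_assoc, superSym_mul_comm hy hx, smul_mul_assoc, mul_assoc]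
  | trans h _ ih ih' =>
    obtain ⟨ε, h0, h1⟩ := ih hl
    obtain ⟨ε', h0', h1'⟩ := ih' fun y hy => hl y (h.mem_iff.mpr hy)
    exact ⟨ε * ε', mul_ne_zero h0 h0', by rw [h1, h1', smul_smul]⟩

theorem coordMap_mem {n : ℕ} (i : Fin n) {d d' : ℕ} {a : SuperSym k V₀ V₁}
    (ha : a ∈ superSymPiece k V₀ V₁ d d') :
    coordMap k V₀ V₁ i a ∈ superSymPiece k (Fin n → V₀) (Fin n → V₁) d d' :=
  superMap_mem_superSymPiece _ _ ha

/-- A permutation of the coordinates permutes the products of bihomogeneous elements up to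
signs. -/
theorem exists_sign_inr_coordProd {n : ℕ} (σ : Equiv.Perm (Fin n)) {a : Fin n → SuperSym k V₀ V₁}
    (ha : ∀ i, ∃ d d', a i ∈ superSymPiece k V₀ V₁ d d') :
    ∃ ε : k, ε ≠ 0 ∧
      wreathSuperSymRep n ρ₀ ρ₁ (SemidirectProduct.inr σ) (coordProd k V₀ V₁ n a) =
        ε • coordProd k V₀ V₁ n (a ∘ ⇑σ⁻¹) := by
  have h := Equiv.Perm.ofFn_comp_perm σ fun i => coordMap k V₀ V₁ i ((a ∘ ⇑σ⁻¹) i)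
  obtain ⟨ε, h0, hε⟩ := exists_sign_of_perm h (by
    intro x hx
    obtain ⟨i, rfl⟩ := List.mem_ofFn.mp hx
    obtain ⟨d, d', hd⟩ := ha (σ⁻¹ (σ i))
    exact ⟨d, d', coordMap_mem _ hd⟩)
  refine ⟨ε, h0, ?_⟩
  rw [wreathSuperSymRep_inr_coordProd, coordProd_apply, ← hε]
  congr 2
  funext i
  simp

theorem swap_zero_one_coordProd {n : ℕ} {a : Fin (n + 2) → SuperSym k V₀ V₁} (h : a 0 = a 1)
    {d d' : ℕ} (ha : a 0 ∈ superSymPiece k V₀ V₁ d d') :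
    wreathSuperSymRep (n + 2) ρ₀ ρ₁ (SemidirectProduct.inr (Equiv.swap 0 1))
      (coordProd k V₀ V₁ (n + 2) a) = (-1 : k) ^ d' • coordProd k V₀ V₁ (n + 2) a := by
  rw [wreathSuperSymRep_inr_coordProd, coordProd_apply]
  simp only [List.ofFn_succ, List.prod_cons]
  have e0 : (Equiv.swap (0 : Fin (n + 2)) 1) 0 = 1 := Equiv.swap_apply_left _ _
  have e1 : (Equiv.swap (0 : Fin (n + 2)) 1) (Fin.succ 0) = 0 := Equiv.swap_apply_right _ _
  have e2 : ∀ i : Fin n, (Equiv.swap (0 : Fin (n + 2)) 1) i.succ.succ = i.succ.succ := fun i =>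
    Equiv.swap_apply_of_ne_of_ne (Fin.succ_ne_zero _)
      (by rw [← Fin.succ_zero_eq_one, Ne, Fin.succ_inj]; exact Fin.succ_ne_zero _)
  rw [e0, e1]
  simp only [e2]
  have h1 : a (Fin.succ 0) = a 0 := h.symm
  rw [h1, ← mul_assoc, ← mul_assoc,
    superSym_mul_comm (coordMap_mem (1 : Fin (n + 2)) ha) (coordMap_mem 0 ha), smul_mul_assoc]
  congr 1
  rcases Nat.even_or_odd d' with h | h
  · rw [h.neg_one_pow, (h.mul_left d').neg_one_pow]
  · rw [h.neg_one_pow, (h.mul h).neg_one_pow]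

/-- A transposition of two coordinates carrying the same bihomogeneous element acts by the sign
of its exterior degree. -/
theorem swap_coordProd {n : ℕ} {a : Fin n → SuperSym k V₀ V₁}
    (ha : ∀ i, ∃ d d', a i ∈ superSymPiece k V₀ V₁ d d') {x y : Fin n} (hxy : x ≠ y)
    (h : a x = a y) {d d' : ℕ} (hd : a x ∈ superSymPiece k V₀ V₁ d d') :
    wreathSuperSymRep n ρ₀ ρ₁ (SemidirectProduct.inr (Equiv.swap x y)) (coordProd k V₀ V₁ n a) =
      (-1 : k) ^ d' • coordProd k V₀ V₁ n a := by
  obtain ⟨m, rfl⟩ : ∃ m, n = m + 2 := by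
    refine ⟨n - 2, ?_⟩
    have hne : (x : ℕ) ≠ y := fun h => hxy (Fin.ext h)
    have := x.2
    have := y.2
    omega
  -- The transposition is conjugate to that of the first two coordinates.
  obtain ⟨τ, h0, h1⟩ : ∃ τ : Equiv.Perm (Fin (m + 2)), τ 0 = x ∧ τ 1 = y := by
    refine ⟨Equiv.swap y (Equiv.swap x 0 1) * Equiv.swap x 0, ?_, ?_⟩
    · rw [Equiv.Perm.mul_apply, Equiv.swap_apply_right]
      refine Equiv.swap_apply_of_ne_of_ne hxy fun h => ?_
      have h2 : Equiv.swap x 0 0 = Equiv.swap x 0 1 := by rw [← h, Equiv.swap_apply_right]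
      simpa using (Equiv.swap x 0).injective h2
    · rw [Equiv.Perm.mul_apply, Equiv.swap_apply_right]
  obtain ⟨ε, -, hε⟩ := exists_sign_inr_coordProd ρ₀ ρ₁ τ⁻¹ ha
  have hswap : Equiv.swap x y = τ * Equiv.swap 0 1 * τ⁻¹ := by
    rw [← h0, ← h1, Equiv.swap_apply_apply]
  have hinv : wreathSuperSymRep (m + 2) ρ₀ ρ₁ (SemidirectProduct.inr τ)
      (ε • coordProd k V₀ V₁ (m + 2) (a ∘ ⇑τ⁻¹⁻¹)) = coordProd k V₀ V₁ (m + 2) a := by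
    rw [← hε, ← Module.End.mul_apply, ← map_mul, ← map_mul, mul_inv_cancel, map_one, map_one]
    rfl
  rw [hswap, map_mul, map_mul, map_mul, map_mul, Module.End.mul_apply, Module.End.mul_apply, hε,
    map_smul, swap_zero_one_coordProd ρ₀ ρ₁ (d := d) (d' := d') (by simp [h0, h1, h])
      (by simpa [h0] using hd), smul_comm, map_smul, hinv]

theorem coordProd_mem {n : ℕ} {a : Fin n → SuperSym k V₀ V₁} {d : Fin n → ℕ × ℕ}
    (ha : ∀ i, a i ∈ superSymPiece k V₀ V₁ (d i).1 (d i).2) :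
    coordProd k V₀ V₁ n a ∈
      superSymPiece k (Fin n → V₀) (Fin n → V₁) (∑ i, d i).1 (∑ i, d i).2 := by
  have key : ∀ (l : List (Fin n)),
      (l.map fun i => coordMap k V₀ V₁ i (a i)).prod ∈
        superSymPiece k (Fin n → V₀) (Fin n → V₁) (l.map d).sum.1 (l.map d).sum.2 := by
    intro l
    induction l with
    | nil => exact one_mem_superSymPiece
    | cons i l ih =>
      simp only [List.map_cons, List.prod_cons, List.sum_cons, Prod.fst_add, Prod.snd_add]
      exact mul_mem_superSymPiece (coordMap_mem i (ha i)) ih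
  have := key (List.finRange n)
  rwa [← List.ofFn_eq_map, ← List.ofFn_eq_map, List.sum_ofFn, ← coordProd_apply] at this

end WreathAction

/-! ### Relative invariants of monomial representations of the symmetric group -/

section Monomial

/-- The permutations preserving a function on a finite type are generated by the transpositions
of two points with the same value. -/
theorem mem_closure_swap_of_comp_eq {ι X : Type*} [Finite ι] [DecidableEq ι] {s : ι → X}
    {σ : Equiv.Perm ι} (h : s ∘ σ = s) :
    σ ∈ Subgroup.closure {τ : Equiv.Perm ι | ∃ x y, x ≠ y ∧ s x = s y ∧ τ = Equiv.swap x y} := by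
  rw [mem_closure_isSwap]
  · refine ⟨Set.toFinite _, fun x => ?_⟩
    by_cases hx : x = σ x
    · rw [← hx]; exact MulAction.mem_orbit_self _
    · exact ⟨⟨Equiv.swap x (σ x),
        Subgroup.subset_closure ⟨x, σ x, hx, (congrFun h x).symm, rfl⟩⟩, Equiv.swap_apply_left _ _⟩
  · rintro _ ⟨x, y, hxy, -, rfl⟩
    exact ⟨x, y, hxy, rfl⟩

variable {k M X : Type*} [Field k] [AddCommGroup M] [Module k M] {n : ℕ}
  (P : Representation k (Equiv.Perm (Fin n)) M) (χ : Equiv.Perm (Fin n) →* kˣ)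
  (E : Module.Basis (Fin n → X) k M)

/-- If the transpositions preserving `s` act on `w` through `χ`, so does the stabilizer of `s`. -/
theorem apply_eq_smul_of_comp_eq {w : M} {s : Fin n → X}
    (hs : ∀ x y, x ≠ y → s x = s y → P (Equiv.swap x y) w = (χ (Equiv.swap x y) : k) • w)
    {σ : Equiv.Perm (Fin n)} (h : s ∘ σ = s) : P σ w = (χ σ : k) • w := by
  have hσ := mem_closure_swap_of_comp_eq h
  clear h
  induction hσ using Subgroup.closure_induction with
  | mem _ hx =>
    obtain ⟨x, y, hxy, hs', rfl⟩ := hx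
    exact hs x y hxy hs'
  | one => simp
  | mul σ τ _ _ hσ hτ =>
    rw [map_mul, Module.End.mul_apply, hτ, map_smul, hσ, smul_smul, map_mul, Units.val_mul,
      mul_comm]
  | inv σ _ hσ =>
    have h2 : P σ⁻¹ (P σ w) = w := by
      rw [← Module.End.mul_apply, ← map_mul, inv_mul_cancel, map_one]; rfl
    rw [hσ, map_smul] at h2
    rw [map_inv χ, ← Units.smul_def, eq_inv_smul_iff, Units.smul_def]
    exact h2

theorem repr_perm_apply {σ : Equiv.Perm (Fin n)} {ε : (Fin n → X) → k}
    (h : ∀ s, P σ (E s) = ε s • E (s ∘ ⇑σ⁻¹)) (f : M) (s : Fin n → X) :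
    E.repr (P σ f) s = ε (s ∘ σ) * E.repr f (s ∘ σ) := by
  classical
  have key : (E.coord s) ∘ₗ P σ = ε (s ∘ σ) • E.coord (s ∘ σ) := by
    apply E.ext
    intro t
    simp only [LinearMap.comp_apply, h, map_smul, LinearMap.smul_apply, Module.Basis.coord_apply,
      Module.Basis.repr_self, smul_eq_mul, Finsupp.single_apply]
    by_cases ht : t = s ∘ σ
    · subst ht
      have hs : (s ∘ σ) ∘ ⇑σ⁻¹ = s := funext fun i => by simp
      rw [hs, if_pos rfl, if_pos rfl]
    · have ht' : t ∘ ⇑σ⁻¹ ≠ s := by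
        rintro rfl
        exact ht (funext fun i => by simp)
      rw [if_neg ht, if_neg ht', mul_zero, mul_zero]
  exact DFunLike.congr_fun key f

/-- Let `𝔖ₙ` permute, up to scalars, a basis indexed by the functions on `n` points. Then the
dimension of the space of `χ`-relative invariants supported on a permutation-invariant set `Q` of
basis vectors is the number of orbits in `Q` on which the stabilizer acts through `χ`. -/
theorem finrank_relInvariants_monomial [CharZero k]
    (hP : ∀ σ s, ∃ ε : k, ε ≠ 0 ∧ P σ (E s) = ε • E (s ∘ ⇑σ⁻¹))
    (Q : (Fin n → X) → Prop) (hQ : ∀ s (σ : Equiv.Perm (Fin n)), Q s → Q (s ∘ σ))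
    (U : Submodule k M)
    (hU : ∀ f, f ∈ U ↔ (∀ σ, P σ f = (χ σ : k) • f) ∧ ∀ s, E.repr f s ≠ 0 → Q s)
    {C : Type*} (t : C → Fin n → X) (htQ : ∀ c, Q (t c))
    (htχ : ∀ c x y, x ≠ y → t c x = t c y →
      P (Equiv.swap x y) (E (t c)) = (χ (Equiv.swap x y) : k) • E (t c))
    (ht : ∀ s, Q s → (∀ x y, x ≠ y → s x = s y →
      P (Equiv.swap x y) (E s) = (χ (Equiv.swap x y) : k) • E s) →
        ∃ c, ∃ σ : Equiv.Perm (Fin n), t c = s ∘ σ)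
    (hinj : ∀ c c' (σ : Equiv.Perm (Fin n)), t c = t c' ∘ σ → c = c') :
    Module.finrank k U = Nat.card C := by
  classical
  choose ε hε0 hε using hP
  have hrepr : ∀ (f : M) (σ : Equiv.Perm (Fin n)) (s : Fin n → X),
      E.repr (P σ f) s = ε σ (s ∘ σ) * E.repr f (s ∘ σ) := fun f σ s =>
    repr_perm_apply P E (hε σ) f s
  have tinj : Function.Injective t := fun c c' h => hinj c c' 1 (by simpa using h)
  -- Read off the coordinates at the chosen representatives of the good orbits.
  let Φ : U →ₗ[k] (C →₀ k) :=
    Finsupp.lcomapDomain t tinj ∘ₗ E.repr.toLinearMap ∘ₗ U.subtype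
  have hΦ : ∀ (f : U) c, Φ f c = E.repr (f : M) (t c) := fun f c => rfl
  have hbij : Function.Bijective Φ := by
    constructor
    · rw [injective_iff_map_eq_zero]
      intro f hf
      obtain ⟨hχ, hsupp⟩ := (hU f).mp f.2
      ext1
      refine E.repr.injective (Finsupp.ext fun s => ?_)
      rw [ZeroMemClass.coe_zero, map_zero, Finsupp.zero_apply]
      by_contra hne
      have hs := hsupp s hne
      by_cases hgood : ∀ x y, x ≠ y → s x = s y →
          P (Equiv.swap x y) (E s) = (χ (Equiv.swap x y) : k) • E s
      · obtain ⟨c, σ, hc⟩ := ht s hs hgood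
        have h1 := hrepr f σ s
        rw [hχ σ, map_smul, Finsupp.smul_apply, ← hc, ← hΦ, hf, Finsupp.zero_apply, mul_zero,
          smul_eq_mul] at h1
        exact (mul_ne_zero (χ σ).ne_zero hne) h1
      · -- A transposition fixing `s` acts on `E s` by a scalar other than its value under `χ`,
        -- which forces the coordinate of `f` at `s` to vanish.
        push Not at hgood
        obtain ⟨x, y, hxy, hsxy, hbad⟩ := hgood
        have hcomp : s ∘ Equiv.swap x y = s := by
          funext i
          rw [Function.comp_apply, Equiv.swap_apply_def]
          split_ifs with h1 h2
          · rw [h1, hsxy]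
          · rw [h2, hsxy]
          · rfl
        have h1 := hrepr f (Equiv.swap x y) s
        rw [hχ, map_smul, Finsupp.smul_apply, hcomp, smul_eq_mul] at h1
        apply hbad
        rw [hε, Equiv.swap_inv, hcomp, mul_right_cancel₀ hne h1]
    · rw [← LinearMap.range_eq_top, eq_top_iff, ← Finsupp.basisSingleOne.span_eq, Submodule.span_le]
      rintro _ ⟨c, rfl⟩
      -- The coordinate at `t c` of the `χ`-twisted sum over the orbit is the order of the
      -- stabilizer.
      let F : M := ∑ σ : Equiv.Perm (Fin n), ((χ σ)⁻¹ : kˣ) • P σ (E (t c))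
      have hFU : F ∈ U := by
        refine (hU F).mpr ⟨fun τ => ?_, fun s hs => ?_⟩
        · simp only [F, map_sum, Finset.smul_sum]
          refine Fintype.sum_equiv (Equiv.mulLeft τ) _ _ fun σ => ?_
          rw [Equiv.coe_mulLeft, Units.smul_def, map_smul, ← Module.End.mul_apply, ← map_mul,
            Units.smul_def, smul_smul, ← Units.val_mul]
          congr 2
          rw [map_mul, mul_inv, mul_inv_cancel_left]
        · simp only [F, map_sum, Finsupp.finsetSum_apply] at hs
          obtain ⟨σ, -, hσ⟩ := Finset.exists_ne_zero_of_sum_ne_zero hs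
          rw [Units.smul_def, map_smul, Finsupp.smul_apply, hε, map_smul, Finsupp.smul_apply,
            Module.Basis.repr_self] at hσ
          have : t c ∘ ⇑σ⁻¹ = s := by
            by_contra hne
            exact hσ (by rw [Finsupp.single_eq_of_ne' hne, smul_zero, smul_zero])
          rw [← this]
          exact hQ _ _ (htQ c)
      let N : ℕ := (Finset.univ.filter fun σ : Equiv.Perm (Fin n) => t c ∘ σ = t c).card
      have hN : (N : k) ≠ 0 := by
        rw [Nat.cast_ne_zero]
        exact Finset.card_ne_zero_of_mem (a := 1) (by simp)
      have hcoef : Φ ⟨F, hFU⟩ = (N : k) • Finsupp.single c 1 := by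
        ext c'
        rw [hΦ]
        simp only [F, map_sum, Finsupp.finsetSum_apply, Units.smul_def, map_smul,
          Finsupp.smul_apply]
        by_cases hc : c' = c
        · subst hc
          rw [Finsupp.single_eq_same, smul_eq_mul, mul_one]
          simp only [N, Finset.card_filter, Nat.cast_sum]
          refine Finset.sum_congr rfl fun σ _ => ?_
          split_ifs with hσ
          · rw [apply_eq_smul_of_comp_eq P χ (htχ c') hσ]
            simp
          · rw [hrepr, Module.Basis.repr_self, Finsupp.single_eq_of_ne hσ]
            simp
        · rw [Finsupp.single_eq_of_ne hc, smul_zero]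
          refine Finset.sum_eq_zero fun σ _ => ?_
          rw [hrepr, Module.Basis.repr_self, Finsupp.single_eq_of_ne, mul_zero, smul_zero]
          exact fun h => hc (hinj c c' σ h.symm).symm
      refine ⟨(N : k)⁻¹ • ⟨F, hFU⟩, ?_⟩
      rw [map_smul, hcoef, smul_smul, inv_mul_cancel₀ hN, one_smul]
      simp
  exact Module.finrank_eq_nat_card_basis ⟨LinearEquiv.ofBijective Φ hbij⟩

end Monomial

/-! ### Bases adapted to the invariants -/

section AdaptedBasis

variable {k : Type*} [Field k] {H : Type*} [Group H]
variable {V₀ V₁ : Type*} [AddCommGroup V₀] [Module k V₀] [AddCommGroup V₁] [Module k V₁]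
  (ρ₀ : Representation k H V₀) (ρ₁ : Representation k H V₁)

/-- A stable finite-dimensional subspace is the direct sum of its invariants and of the kernel of
the averaging operator. -/
theorem exists_average_basis [CharZero k] [Fintype H] {W : Type*} [AddCommGroup W] [Module k W]
    (ρ : Representation k H W) (N : Submodule k W) [FiniteDimensional k N]
    (hN : ∀ h, ∀ a ∈ N, ρ h a ∈ N) :
    ∃ (d : ℕ) (b : Module.Basis (Fin (Module.finrank k ↥(ρ.invariants ⊓ N)) ⊕ Fin d) k N),
      (∀ i, (b (Sum.inl i) : W) ∈ ρ.invariants) ∧ ∀ i, ∑ h, ρ h (b (Sum.inr i)) = 0 := by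
  let I : Submodule k N := ρ.invariants.comap N.subtype
  let R : N →ₗ[k] N := (Fintype.card H : k)⁻¹ • ∑ h, (ρ h).restrict (hN h)
  have hR : ∀ a : N, (R a : W) =
      (Fintype.card H : k)⁻¹ • ∑ h, ρ h (a : W) := fun a => by
    simp [R, LinearMap.sum_apply]
  have hcard : (Fintype.card H : k) ≠ 0 := Nat.cast_ne_zero.mpr Fintype.card_ne_zero
  have hproj : LinearMap.IsProj I R := by
    refine ⟨fun a g => ?_, fun a ha => ?_⟩
    · change ρ g (R a : W) = R a
      rw [hR, map_smul, map_sum]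
      congr 1
      refine Fintype.sum_equiv (Equiv.mulLeft g) _ _ fun h => ?_
      rw [Equiv.coe_mulLeft, map_mul]
      rfl
    · ext1
      have ha' : ∀ h, ρ h (a : W) = a := ha
      rw [hR]
      simp only [ha', Finset.sum_const, Finset.card_univ]
      rw [← Nat.cast_smul_eq_nsmul k, smul_smul, inv_mul_cancel₀ hcard, one_smul]
  have hI : Module.finrank k I = Module.finrank k ↥(ρ.invariants ⊓ N) := by
    rw [inf_comm, ← Submodule.map_comap_subtype, Submodule.finrank_map_subtype_eq]
  let bI := Module.finBasisOfFinrankEq k I hI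
  let bK := Module.finBasis k (LinearMap.ker R)
  refine ⟨_, (bI.prod bK).map (Submodule.prodEquivOfIsCompl _ _ hproj.isCompl), fun i => ?_,
    fun i => ?_⟩
  · have h : ((bI.prod bK).map (Submodule.prodEquivOfIsCompl _ _ hproj.isCompl)) (Sum.inl i) =
        (bI i : N) := by simp
    rw [h]
    exact (bI i).2
  · have h : ((bI.prod bK).map (Submodule.prodEquivOfIsCompl _ _ hproj.isCompl)) (Sum.inr i) =
        (bK i : N) := by simp
    rw [h]
    have h2 := congrArg Subtype.val (LinearMap.mem_ker.mp (bK i).2)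
    rw [hR, ZeroMemClass.coe_zero, smul_eq_zero] at h2
    exact h2.resolve_left (inv_ne_zero hcard)

/-- A bihomogeneous basis of `Sym(V₀) ⊗ ⋀(V₁)` made of a basis of the invariants and of elements
with zero average. -/
theorem exists_adapted_basis [CharZero k] [FiniteDimensional k V₀] [FiniteDimensional k V₁]
    [Fintype H] :
    ∃ (K : Type) (D : K → ℕ × ℕ)
      (e : Module.Basis ((Σ p : ℕ × ℕ, Fin (invDim ρ₀ ρ₁ p)) ⊕ K) k (SuperSym k V₀ V₁)),
      (∀ t, e (Sum.inl t) ∈ (superSymRep ρ₀ ρ₁).invariants) ∧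
      (∀ t, e (Sum.inl t) ∈ superSymPiece k V₀ V₁ t.1.1 t.1.2) ∧
      (∀ c, ∑ h, superSymRep ρ₀ ρ₁ h (e (Sum.inr c)) = 0) ∧
      ∀ c, e (Sum.inr c) ∈ superSymPiece k V₀ V₁ (D c).1 (D c).2 := by
  have h0 : ∀ p : ℕ × ℕ, ∃ (d : ℕ) (b : Module.Basis (Fin (invDim ρ₀ ρ₁ p) ⊕ Fin d) k
      (superSymPiece k V₀ V₁ p.1 p.2)),
      (∀ i, (b (Sum.inl i) : SuperSym k V₀ V₁) ∈ (superSymRep ρ₀ ρ₁).invariants) ∧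
      ∀ i, ∑ h, superSymRep ρ₀ ρ₁ h (b (Sum.inr i)) = 0 := fun p =>
    exists_average_basis (superSymRep ρ₀ ρ₁) (superSymPiece k V₀ V₁ p.1 p.2)
      fun h a ha => superMap_mem_superSymPiece _ _ ha
  choose d b hb hb' using h0
  let e := ((superSymPiece_isInternal (k := k) (V₀ := V₀) (V₁ := V₁)).collectedBasis b).reindex
    (Equiv.sigmaSumDistrib _ _)
  have hl : ∀ t, e (Sum.inl t) = b t.1 (Sum.inl t.2) := fun t => by
    simp only [e, Module.Basis.reindex_apply, DirectSum.IsInternal.collectedBasis_coe]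
    rfl
  have hr : ∀ c, e (Sum.inr c) = b c.1 (Sum.inr c.2) := fun c => by
    simp only [e, Module.Basis.reindex_apply, DirectSum.IsInternal.collectedBasis_coe]
    rfl
  refine ⟨Σ p, Fin (d p), fun c => c.1, e, fun t => ?_, fun t => ?_, fun c => ?_, fun c => ?_⟩
  · rw [hl]; exact hb _ _
  · rw [hl]; exact (b t.1 (Sum.inl t.2)).2
  · rw [hr]; exact hb' _ _
  · rw [hr]; exact (b c.1 (Sum.inr c.2)).2

end AdaptedBasis

/-! ### Functions up to permutation and multisets -/

section Counting

/-- Two functions on a finite type taking each value equally often differ by a permutation. -/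
theorem exists_perm_of_sum_single_eq {ι T : Type*} [Fintype ι] {s s' : ι → T}
    (h : ∑ x, Finsupp.single (s x) 1 = ∑ x, Finsupp.single (s' x) 1) :
    ∃ σ : Equiv.Perm ι, s = s' ∘ σ := by
  classical
  have hcard : ∀ t, Nonempty ({x // s x = t} ≃ {x // s' x = t}) := fun t => by
    have h2 := DFunLike.congr_fun h t
    simp only [Finsupp.finsetSum_apply, Finsupp.single_apply] at h2
    rw [← Finset.card_filter, ← Finset.card_filter] at h2
    exact ⟨Fintype.equivOfCardEq (by rw [Fintype.card_subtype, Fintype.card_subtype]; exact h2)⟩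
  let f := fun t => (hcard t).some
  refine ⟨(Equiv.sigmaFiberEquiv s).symm.trans
    ((Equiv.sigmaCongrRight f).trans (Equiv.sigmaFiberEquiv s')), funext fun x => ?_⟩
  exact (f (s x) ⟨x, rfl⟩).2.symm

theorem exists_sum_single_eq {T : Type*} (n : ℕ) (μ : T →₀ ℕ)
    (h : Finsupp.linearCombination ℕ (fun _ => 1) μ = n) :
    ∃ s : Fin n → T, ∑ x, Finsupp.single (s x) 1 = μ := by
  induction n generalizing μ with
  | zero =>
    refine ⟨Fin.elim0, ?_⟩
    rw [Finsupp.linearCombination_apply, Finsupp.sum, Finset.sum_eq_zero_iff] at h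
    ext t
    by_contra hne
    rw [Finset.univ_eq_empty, Finset.sum_empty, Finsupp.zero_apply] at hne
    have := h t (Finsupp.mem_support_iff.mpr (Ne.symm hne))
    rw [smul_eq_mul, mul_one] at this
    exact hne this.symm
  | succ n ih =>
    obtain ⟨t, ht⟩ : ∃ t, μ t ≠ 0 := by
      by_contra! h0
      have : μ = 0 := Finsupp.ext h0
      rw [this, map_zero] at h
      simp at h
    have hle : Finsupp.single t 1 ≤ μ := by
      rw [Finsupp.single_le_iff]; omega
    obtain ⟨ν, rfl⟩ := exists_add_of_le hle
    obtain ⟨s, hs⟩ := ih ν (by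
      rw [map_add, Finsupp.linearCombination_single] at h
      simp only [smul_eq_mul, mul_one] at h ⊢
      omega)
    exact ⟨Fin.cons t s, by simp [Fin.sum_univ_succ, hs]⟩

/-- The exponent of the monomial `t qⁱ uʲ`, for `p = (i, j)`. -/
noncomputable def tquExponent (p : ℕ × ℕ) : Fin 3 →₀ ℕ :=
  Finsupp.single 0 1 + Finsupp.single 1 p.1 + Finsupp.single 2 p.2

theorem tquExponent_zero (p : ℕ × ℕ) : tquExponent p 0 = 1 := by simp [tquExponent]
theorem tquExponent_one (p : ℕ × ℕ) : tquExponent p 1 = p.1 := by simp [tquExponent]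
theorem tquExponent_two (p : ℕ × ℕ) : tquExponent p 2 = p.2 := by simp [tquExponent]

theorem sum_tquExponent_eq_iff {n : ℕ} (D : Fin n → ℕ × ℕ) (m : Fin 3 →₀ ℕ) :
    ∑ x, tquExponent (D x) = m ↔ n = m 0 ∧ ∑ x, D x = (m 1, m 2) := by
  rw [Finsupp.ext_iff, Fin.forall_fin_succ, Fin.forall_fin_succ, Fin.forall_fin_succ, Prod.ext_iff]
  simp [Finsupp.finsetSum_apply, tquExponent_zero, tquExponent_one, tquExponent_two,
    Prod.fst_sum, Prod.snd_sum]

end Counting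

/-! ### Dimensions of the components of the relative invariants -/

section Dimension

variable {k : Type*} [Field k] {H : Type*} [Group H]
variable {V₀ V₁ : Type*} [AddCommGroup V₀] [Module k V₀] [AddCommGroup V₁] [Module k V₁]
  (ρ₀ : Representation k H V₀) (ρ₁ : Representation k H V₁)

/-- The coordinates of a bihomogeneous element in a bihomogeneous basis vanish outside of its
bidegree. -/
theorem bidegree_eq_of_repr_ne_zero {X : Type*} (E : Module.Basis X k (SuperSym k V₀ V₁))
    {D : X → ℕ × ℕ} (hE : ∀ x, E x ∈ superSymPiece k V₀ V₁ (D x).1 (D x).2) {i j : ℕ}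
    {f : SuperSym k V₀ V₁} (hf : f ∈ superSymPiece k V₀ V₁ i j) {x : X} (hx : E.repr f x ≠ 0) :
    D x = (i, j) := by
  classical
  by_contra hne
  have key : E.coord x ∘ₗ superProj k V₀ V₁ i j = 0 := by
    apply E.ext
    intro y
    rw [LinearMap.comp_apply, LinearMap.zero_apply]
    by_cases hy : D y = (i, j)
    · have h1 : E y ∈ superSymPiece k V₀ V₁ i j := by simpa [hy] using hE y
      have hyx : x ≠ y := by rintro rfl; exact hne hy
      rw [superProj_of_mem h1, Module.Basis.coord_apply, Module.Basis.repr_self,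
        Finsupp.single_eq_of_ne hyx]
    · rw [superProj_of_mem_of_ne hy (hE y), map_zero]
  have h := DFunLike.congr_fun key f
  rw [LinearMap.comp_apply, superProj_of_mem hf] at h
  exact hx h

/-- An element invariant under `Hⁿ` only involves products of invariants. -/
theorem exists_inl_of_repr_ne_zero [CharZero k] [Fintype H] {T K : Type*} {n : ℕ}
    (e : Module.Basis (T ⊕ K) k (SuperSym k V₀ V₁))
    (heT : ∀ t, e (Sum.inl t) ∈ (superSymRep ρ₀ ρ₁).invariants)
    (heK : ∀ c, ∑ h, superSymRep ρ₀ ρ₁ h (e (Sum.inr c)) = 0)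
    (E : Module.Basis (Fin n → T ⊕ K) k (SuperSym k (Fin n → V₀) (Fin n → V₁)))
    (hE : ∀ s, E s = coordProd k V₀ V₁ n fun i => e (s i))
    {f : SuperSym k (Fin n → V₀) (Fin n → V₁)}
    (hf : ∀ g, wreathSuperSymRep n ρ₀ ρ₁ (SemidirectProduct.inl g) f = f)
    {s : Fin n → T ⊕ K} (hs : E.repr f s ≠ 0) (i : Fin n) : ∃ t, s i = Sum.inl t := by
  classical
  rcases hsi : s i with t | c
  · exact ⟨t, rfl⟩
  exfalso
  -- The sum over `Hⁿ` has no component along `E s`, but it multiplies `f` by the order of `Hⁿ`.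
  have key : E.coord s ∘ₗ
      (∑ g : Fin n → H, wreathSuperSymRep n ρ₀ ρ₁ (SemidirectProduct.inl g)) = 0 := by
    apply E.ext
    intro s'
    rw [LinearMap.comp_apply, LinearMap.zero_apply, LinearMap.sum_apply]
    by_cases h : ∀ i, ∃ t, s' i = Sum.inl t
    · have h1 : ∀ g : Fin n → H,
          wreathSuperSymRep n ρ₀ ρ₁ (SemidirectProduct.inl g) (E s') = E s' := fun g => by
        rw [hE, wreathSuperSymRep_inl_coordProd]
        congr 1
        funext j
        obtain ⟨t, ht⟩ := h j
        rw [ht]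
        exact heT t (g j)
      have hne : s ≠ s' := by
        rintro rfl
        obtain ⟨t, ht⟩ := h i
        rw [hsi] at ht
        cases ht
      rw [Finset.sum_congr rfl fun g _ => h1 g, Finset.sum_const, map_nsmul,
        Module.Basis.coord_apply, Module.Basis.repr_self, Finsupp.single_eq_of_ne hne, smul_zero]
    · push Not at h
      obtain ⟨j, hj⟩ := h
      rw [hE, sum_inl_coordProd]
      rcases hsj : s' j with t | c'
      · exact absurd hsj (hj t)
      · rw [MultilinearMap.map_coord_zero _ j (by rw [hsj]; exact heK c'), map_zero]
  have h := DFunLike.congr_fun key f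
  rw [LinearMap.comp_apply, LinearMap.zero_apply, LinearMap.sum_apply,
    Finset.sum_congr rfl fun g _ => hf g, Finset.sum_const, map_nsmul, Module.Basis.coord_apply,
    Finset.card_univ, ← Nat.cast_smul_eq_nsmul k, smul_eq_zero, Nat.cast_eq_zero] at h
  exact h.elim Fintype.card_ne_zero hs

set_option maxHeartbeats 1000000 in
/-- Let `χ` be a character of `𝔖ₙ` and let `Ex` be the set of the exterior degrees `j` for which
the sign `(-1)ʲ` differs from the value of `χ` at transpositions. The dimension of a component of
the `χ`-relative invariants of `𝔖ₙ[H]` is the number of multisets of `n` basis invariants of `H` of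
given total bidegree, those with exterior degree in `Ex` being taken at most once. -/
theorem finrank_relInvariants_inf_piece [CharZero k] [FiniteDimensional k V₀]
    [FiniteDimensional k V₁] [Fintype H] (m : Fin 3 →₀ ℕ) (χ : Equiv.Perm (Fin (m 0)) →* kˣ)
    (Ex : ℕ → Prop)
    (hχ : ∀ x y, x ≠ y → ∀ j, (-1 : k) ^ j = (χ (Equiv.swap x y) : k) ↔ ¬ Ex j) :
    Module.finrank k ↥(relInvariants (wreathSuperSymRep (m 0) ρ₀ ρ₁)
        (χ.comp SemidirectProduct.rightHom) ⊓
        superSymPiece k (Fin (m 0) → V₀) (Fin (m 0) → V₁) (m 1) (m 2)) =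
      Nat.card {μ : (Σ p : ℕ × ℕ, Fin (invDim ρ₀ ρ₁ p)) →₀ ℕ //
        (∀ t, Ex t.1.2 → μ t ≤ 1) ∧
          Finsupp.linearCombination ℕ (fun t => tquExponent t.1) μ = m} := by
  classical
  obtain ⟨K, D, e, heT, heT', heK, heK'⟩ := exists_adapted_basis ρ₀ ρ₁
  let T := Σ p : ℕ × ℕ, Fin (invDim ρ₀ ρ₁ p)
  let D' : T ⊕ K → ℕ × ℕ := Sum.elim (fun t => t.1) D
  have he : ∀ x, e x ∈ superSymPiece k V₀ V₁ (D' x).1 (D' x).2 := by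
    rintro (t | c)
    · exact heT' t
    · exact heK' c
  obtain ⟨E, hE⟩ := exists_coordProd_basis e (m 0)
  have hEmem : ∀ s, E s ∈ superSymPiece k (Fin (m 0) → V₀) (Fin (m 0) → V₁)
      (∑ i, D' (s i)).1 (∑ i, D' (s i)).2 := fun s => by
    rw [hE]; exact coordProd_mem fun i => he (s i)
  let P : Representation k (Equiv.Perm (Fin (m 0)))
      (SuperSym k (Fin (m 0) → V₀) (Fin (m 0) → V₁)) :=
    MonoidHom.comp (wreathSuperSymRep (m 0) ρ₀ ρ₁) SemidirectProduct.inr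
  have hswap : ∀ (s : Fin (m 0) → T ⊕ K) x y, x ≠ y → s x = s y →
      P (Equiv.swap x y) (E s) = (-1 : k) ^ (D' (s x)).2 • E s := fun s x y hxy hs => by
    rw [hE]
    exact swap_coordProd ρ₀ ρ₁ (fun i => ⟨_, _, he (s i)⟩) hxy (by rw [hs]) (he (s x))
  have hsum : ∀ s : Fin (m 0) → T,
      Finsupp.linearCombination ℕ (fun t : T => tquExponent t.1) (∑ x, Finsupp.single (s x) 1) =
        ∑ x, tquExponent (s x).1 := fun s => by
    simp [map_sum]
  have hdeg : ∀ μ : T →₀ ℕ, Finsupp.linearCombination ℕ (fun t : T => tquExponent t.1) μ = m →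
      Finsupp.linearCombination ℕ (fun _ => 1) μ = m 0 := fun μ hμ => by
    have h := congrArg (Finsupp.lapply (R := ℕ) (0 : Fin 3)) hμ
    rw [Finsupp.apply_linearCombination] at h
    rw [← Finsupp.lapply_apply (R := ℕ), ← h]
    congr 2
    funext t
    exact (tquExponent_zero _).symm
  -- For each admissible multiset, choose an enumeration of its elements.
  choose r hr using fun c : {μ : T →₀ ℕ // (∀ t, Ex t.1.2 → μ t ≤ 1) ∧
      Finsupp.linearCombination ℕ (fun t : T => tquExponent t.1) μ = m} =>
    exists_sum_single_eq (m 0) c.1 (hdeg c.1 c.2.2)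
  refine finrank_relInvariants_monomial P χ E (fun σ s => ?_)
    (fun s => (∀ i, ∃ t, s i = Sum.inl t) ∧ ∑ i, D' (s i) = (m 1, m 2))
    (fun s σ hs => ⟨fun i => hs.1 (σ i), ?_⟩) _ (fun f => ⟨fun hf => ⟨fun σ => ?_, fun s hs => ?_⟩,
      fun hf => ?_⟩) (fun c i => Sum.inl (r c i)) (fun c => ⟨fun i => ⟨_, rfl⟩, ?_⟩)
    (fun c x y hxy hc => ?_) (fun s hs hgood => ?_) (fun c c' σ hc => ?_)
  · obtain ⟨ε, h0, hε⟩ := exists_sign_inr_coordProd ρ₀ ρ₁ σ (a := fun i => e (s i))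
      fun i => ⟨_, _, he (s i)⟩
    exact ⟨ε, h0, by rw [hE, hE]; exact hε⟩
  · rw [← hs.2]
    exact Equiv.sum_comp σ fun i => D' (s i)
  · exact hf.1 (SemidirectProduct.inr σ)
  · refine ⟨exists_inl_of_repr_ne_zero ρ₀ ρ₁ e heT heK E hE (fun g => ?_) hs,
      bidegree_eq_of_repr_ne_zero E hEmem hf.2 hs⟩
    have h := hf.1 (SemidirectProduct.inl g)
    rwa [MonoidHom.comp_apply, SemidirectProduct.rightHom_inl, map_one, Units.val_one,
      one_smul] at h
  · obtain ⟨hf1, hf2⟩ := hf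
    refine ⟨fun x => ?_, ?_⟩
    · have hinl : ∀ g, wreathSuperSymRep (m 0) ρ₀ ρ₁ (SemidirectProduct.inl g) f = f := fun g => by
        rw [← E.linearCombination_repr f, Finsupp.linearCombination_apply, Finsupp.sum, map_sum]
        refine Finset.sum_congr rfl fun s hs => ?_
        rw [map_smul, hE, wreathSuperSymRep_inl_coordProd]
        congr 2
        funext i
        obtain ⟨t, ht⟩ := (hf2 s (Finsupp.mem_support_iff.mp hs)).1 i
        rw [ht]
        exact heT t (g i)
      rw [← SemidirectProduct.inl_left_mul_inr_right x, map_mul, Module.End.mul_apply]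
      have h1 : wreathSuperSymRep (m 0) ρ₀ ρ₁ (SemidirectProduct.inr x.right) f =
        (χ x.right : k) • f := hf1 x.right
      rw [h1, map_smul, hinl]
      simp
    · rw [← E.linearCombination_repr f, Finsupp.linearCombination_apply, Finsupp.sum]
      refine Submodule.sum_mem _ fun s hs => Submodule.smul_mem _ _ ?_
      have h := hEmem s
      rwa [(hf2 s (Finsupp.mem_support_iff.mp hs)).2] at h
  · have h := c.2.2
    rw [← hr c, hsum, sum_tquExponent_eq_iff] at h
    exact h.2
  · have hxy' : r c x = r c y := Sum.inl_injective hc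
    rw [hswap _ x y hxy hc]
    congr 1
    refine (hχ x y hxy _).mpr fun hEx => ?_
    have h1 := c.2.1 (r c x) hEx
    rw [← hr c, Finsupp.finsetSum_apply] at h1
    have h2 := Finset.sum_le_sum_of_subset
      (f := fun z => (Finsupp.single (r c z) 1 : T →₀ ℕ) (r c x))
      (Finset.subset_univ {x, y})
    rw [Finset.sum_pair hxy, hxy', Finsupp.single_eq_same] at h2
    rw [hxy'] at h1
    omega
  · choose s' hs' using hs.1
    obtain rfl : s = fun i => Sum.inl (s' i) := funext hs'
    have hμ2 : Finsupp.linearCombination ℕ (fun t : T => tquExponent t.1)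
        (∑ x, Finsupp.single (s' x) 1) = m := by
      rw [hsum, sum_tquExponent_eq_iff]
      exact ⟨rfl, hs.2⟩
    have hμ1 : ∀ t : T, Ex t.1.2 → (∑ x, Finsupp.single (s' x) 1 : T →₀ ℕ) t ≤ 1 := by
      intro t ht
      by_contra! hlt
      simp only [Finsupp.finsetSum_apply, Finsupp.single_apply] at hlt
      rw [← Finset.card_filter, Finset.one_lt_card] at hlt
      obtain ⟨x, hx, y, hy, hxy⟩ := hlt
      rw [Finset.mem_filter] at hx hy
      have hsxy : s' x = s' y := hx.2.trans hy.2.symm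
      have h1 := hgood x y hxy (congrArg Sum.inl hsxy)
      rw [hswap _ x y hxy (congrArg Sum.inl hsxy)] at h1
      have h2 := smul_left_injective k (E.ne_zero _) h1
      refine (hχ x y hxy _).mp h2 ?_
      change Ex (s' x).1.2
      rw [hx.2]
      exact ht
    obtain ⟨σ, hσ⟩ := exists_perm_of_sum_single_eq (hr ⟨_, hμ1, hμ2⟩)
    exact ⟨_, σ, funext fun i => congrArg Sum.inl (congrFun hσ i)⟩
  · have h : ∀ x, r c x = r c' (σ x) := fun x => Sum.inl_injective (congrFun hc x)
    ext1
    rw [← hr c, ← hr c', Finset.sum_congr rfl fun x _ => by rw [h x]]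
    exact Equiv.sum_comp σ fun x => Finsupp.single (r c' x) 1

end Dimension

/-! ### Infinite products and multisets -/

section Products

/-- An infinite product of power series, of which all but finitely many factors are congruent to
`1` modulo a monomial not dividing a given one, converges. -/
theorem multipliable_of_monomial_dvd {σ ι : Type*} (w : ι → σ →₀ ℕ)
    (hw : ∀ m, {i | w i ≤ m}.Finite) (f : ι → MvPowerSeries σ ℤ)
    (hf : ∀ i, MvPowerSeries.monomial (w i) 1 ∣ f i - 1) : Multipliable f := by
  classical
  -- Factors whose monomial does not divide that of exponent `m` do not affect the coefficient
  -- at `m`.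
  have step : ∀ (m : σ →₀ ℕ) (g : MvPowerSeries σ ℤ) (U : Finset ι), (∀ i ∈ U, ¬ w i ≤ m) →
      MvPowerSeries.coeff m (g * ∏ i ∈ U, f i) = MvPowerSeries.coeff m g := by
    intro m g U hU
    induction U using Finset.induction_on with
    | empty => simp
    | insert a s ha ih =>
      obtain ⟨h, hh⟩ := hf a
      rw [Finset.prod_insert ha, eq_add_of_sub_eq hh]
      have e : g * ((MvPowerSeries.monomial (w a) 1 * h + 1) * ∏ i ∈ s, f i) =
          MvPowerSeries.monomial (w a) 1 * (g * h * ∏ i ∈ s, f i) + g * ∏ i ∈ s, f i := by ring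
      rw [e, map_add, ih fun i hi => hU i (Finset.mem_insert_of_mem hi),
        MvPowerSeries.coeff_monomial_mul, if_neg (hU a (Finset.mem_insert_self a s)), zero_add]
  let L : MvPowerSeries σ ℤ := fun m => MvPowerSeries.coeff m (∏ i ∈ (hw m).toFinset, f i)
  refine ⟨L, ?_⟩
  rw [HasProd, SummationFilter.unconditional_filter,
    MvPowerSeries.WithPiTopology.tendsto_iff_coeff_tendsto]
  intro m
  refine tendsto_const_nhds.congr' ?_
  filter_upwards [Filter.eventually_ge_atTop (hw m).toFinset] with U hU
  rw [← Finset.prod_sdiff hU, mul_comm, step]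
  · rfl
  · intro i hi
    rw [Finset.mem_sdiff] at hi
    simpa using hi.2

open scoped Classical in
/-- The sum of the powers of the monomial of exponent `w`, restricted to the powers `0` and `1` if
`ex` holds. -/
noncomputable def powerSum {σ : Type*} (ex : Prop) (w : σ →₀ ℕ) : MvPowerSeries σ ℤ :=
  fun m => if ∃ c : ℕ, (ex → c ≤ 1) ∧ m = c • w then 1 else 0

open scoped Classical in
theorem coeff_powerSum {σ : Type*} (ex : Prop) (w m : σ →₀ ℕ) :
    MvPowerSeries.coeff m (powerSum ex w) =
      if ∃ c : ℕ, (ex → c ≤ 1) ∧ m = c • w then 1 else 0 := rfl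

theorem powerSum_of_exclusive {σ : Type*} {ex : Prop} (hex : ex) {w : σ →₀ ℕ} (hw : w ≠ 0) :
    powerSum ex w = 1 + MvPowerSeries.monomial w 1 := by
  classical
  ext m
  rw [coeff_powerSum, map_add, MvPowerSeries.coeff_one, MvPowerSeries.coeff_monomial]
  by_cases h0 : m = 0
  · subst h0
    rw [if_pos ⟨0, by simp⟩, if_pos rfl, if_neg hw.symm, add_zero]
  by_cases h1 : m = w
  · subst h1
    rw [if_pos ⟨1, by simp⟩, if_neg h0, if_pos rfl, zero_add]
  · rw [if_neg, if_neg h0, if_neg h1, add_zero]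
    rintro ⟨c, hc, rfl⟩
    have := hc hex
    interval_cases c
    · simp at h0
    · simp at h1

theorem powerSum_mul_one_sub {σ : Type*} {ex : Prop} (hex : ¬ ex) {w : σ →₀ ℕ} (hw : w ≠ 0) :
    powerSum ex w * (1 - MvPowerSeries.monomial w 1) = 1 := by
  classical
  ext m
  rw [mul_sub, mul_one, map_sub, MvPowerSeries.coeff_mul_monomial, coeff_powerSum, coeff_powerSum,
    MvPowerSeries.coeff_one]
  by_cases h : ∃ c : ℕ, m = c • w
  · obtain ⟨c, rfl⟩ := h
    rw [if_pos ⟨c, fun h => absurd h hex, rfl⟩]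
    rcases c with _ | c
    · have h1 : ¬ w ≤ 0 • w := by simpa using hw
      rw [if_neg h1]
      simp
    · have h1 : (c + 1) • w ≠ 0 := by simpa using hw
      have h2 : w ≤ (c + 1) • w := by rw [succ_nsmul]; exact le_add_self
      rw [if_neg h1, if_pos h2, if_pos ⟨c, fun h => absurd h hex, by
        rw [succ_nsmul, add_tsub_cancel_right]⟩]
      simp
  · push Not at h
    have h0 : m ≠ 0 := by simpa using h 0
    rw [if_neg h0, if_neg (by rintro ⟨c, -, hc⟩; exact h c hc)]
    split_ifs with h1 h2
    · obtain ⟨c, -, hc⟩ := h2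
      refine absurd ?_ (h (c + 1))
      rw [succ_nsmul, ← hc, tsub_add_cancel_of_le h1]
    · simp
    · simp

/-- The coefficients of a product of sums of powers count multisets. -/
theorem coeff_prod_powerSum {S : Type*} (ex : S → Prop) (w : S → Fin 3 →₀ ℕ)
    (hw : ∀ s, w s 0 = 1) (m : Fin 3 →₀ ℕ) (U : Finset S) (hU : ∀ s, w s ≤ m → s ∈ U) :
    MvPowerSeries.coeff m (∏ s ∈ U, powerSum (ex s) (w s)) =
      Nat.card {μ : S →₀ ℕ // (∀ s, ex s → μ s ≤ 1) ∧ Finsupp.linearCombination ℕ w μ = m} := by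
  classical
  rw [MvPowerSeries.coeff_prod]
  simp_rw [coeff_powerSum, Finset.prod_boole]
  rw [Finset.sum_boole, Nat.cast_inj, ← Fintype.card_coe, ← Nat.card_eq_fintype_card]
  -- A multiset `μ` corresponds to the choice of the `μ s`-th power in the factor of index `s`.
  let L : (S →₀ ℕ) → (S →₀ (Fin 3 →₀ ℕ)) := fun μ =>
    Finsupp.onFinset μ.support (fun s => μ s • w s) fun s hs => by
      rw [Finsupp.mem_support_iff]
      intro h0
      rw [h0, zero_smul] at hs
      exact hs rfl
  have hL : ∀ μ : {μ : S →₀ ℕ // (∀ s, ex s → μ s ≤ 1) ∧ Finsupp.linearCombination ℕ w μ = m},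
      L μ.1 ∈ (Finset.finsuppAntidiag U m).filter
        fun l => ∀ s ∈ U, ∃ c : ℕ, (ex s → c ≤ 1) ∧ l s = c • w s := by
    rintro ⟨μ, h1, h2⟩
    rw [Finset.mem_filter, Finset.mem_finsuppAntidiag]
    rw [Finsupp.linearCombination_apply, Finsupp.sum] at h2
    have hsub : μ.support ⊆ U := fun s hs => by
      refine hU s ?_
      rw [← h2]
      calc w s ≤ μ s • w s :=
            le_smul_of_one_le_left zero_le
              (Nat.one_le_iff_ne_zero.mpr (Finsupp.mem_support_iff.mp hs))
        _ ≤ _ := Finset.single_le_sum (f := fun s => μ s • w s) (fun _ _ => zero_le) hs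
    refine ⟨⟨?_, fun s hs => hsub (Finsupp.support_onFinset_subset hs)⟩,
      fun s _ => ⟨μ s, h1 s, rfl⟩⟩
    refine Eq.trans ?_ h2
    refine (Finset.sum_subset hsub fun s _ hs => ?_).symm
    rw [Finsupp.notMem_support_iff] at hs
    simp [L, hs]
  refine (Nat.card_congr (Equiv.ofBijective (fun μ => ⟨L μ.1, hL μ⟩)
    ⟨fun μ ν h => ?_, fun l => ?_⟩)).symm
  · have h1 := congrArg Subtype.val h
    ext s
    have h2 := DFunLike.congr_fun (DFunLike.congr_fun h1 s) 0
    simpa [L, hw] using h2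
  · obtain ⟨l, hl⟩ := l
    rw [Finset.mem_filter, Finset.mem_finsuppAntidiag] at hl
    obtain ⟨⟨hl1, hl2⟩, hl3⟩ := hl
    have hc : ∀ s, l s = (l s 0) • w s ∧ (ex s → l s 0 ≤ 1) := by
      intro s
      by_cases hs : s ∈ U
      · obtain ⟨c, hc, hc'⟩ := hl3 s hs
        have h0 : l s 0 = c := by rw [hc']; simp [hw]
        exact ⟨by rw [h0, hc'], fun h => h0.le.trans (hc h)⟩
      · have h0 : l s = 0 := by
          by_contra hne
          exact hs (hl2 (Finsupp.mem_support_iff.mpr hne))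
        simp [h0]
    refine ⟨⟨Finsupp.mapRange (fun v : Fin 3 →₀ ℕ => v 0) rfl l, fun s hs => (hc s).2 hs, ?_⟩, ?_⟩
    · rw [Finsupp.linearCombination_apply, Finsupp.sum, ← hl1]
      refine Finset.sum_subset_zero_on_sdiff (fun s hs => hl2 (Finsupp.support_mapRange hs))
        (fun s hs => ?_) fun s _ => (hc s).1.symm
      rw [Finset.mem_sdiff, Finsupp.notMem_support_iff, Finsupp.mapRange_apply] at hs
      rw [(hc s).1, hs.2, zero_smul]
    · ext1
      refine Finsupp.ext fun s => ?_
      exact (hc s).1.symm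

theorem tqu_eq_monomial (p : ℕ × ℕ) : tqu p = MvPowerSeries.monomial (tquExponent p) 1 := by
  rw [tqu, MvPowerSeries.X_pow_eq, MvPowerSeries.X_pow_eq, MvPowerSeries.X,
    MvPowerSeries.monomial_mul_monomial, MvPowerSeries.monomial_mul_monomial, one_mul, one_mul,
    tquExponent]

theorem tquExponent_ne_zero (p : ℕ × ℕ) : tquExponent p ≠ 0 := fun h => by
  have := DFunLike.congr_fun h 0
  rw [tquExponent_zero] at this
  exact one_ne_zero this

theorem mem_of_tquExponent_le {p : ℕ × ℕ} {m : Fin 3 →₀ ℕ} (h : tquExponent p ≤ m) :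
    p ∈ Finset.Iic (m 1, m 2) := by
  rw [Finset.mem_Iic, Prod.le_def]
  exact ⟨(tquExponent_one p).ge.trans (h 1), (tquExponent_two p).ge.trans (h 2)⟩

/-- The generating function of the multisets of elements of weight `t qⁱ uʲ`, with `a (i, j)`
elements of each weight, in which the elements satisfying `Q` occur at most once. -/
theorem isProdQuotient_of_coeff (a : ℕ × ℕ → ℕ) (Q Q' : ℕ × ℕ → Prop) (hQ : ∀ p, Q' p ↔ ¬ Q p)
    (F : MvPowerSeries (Fin 3) ℤ)
    (hF : ∀ m, MvPowerSeries.coeff m F =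
      Nat.card {μ : (Σ p : ℕ × ℕ, Fin (a p)) →₀ ℕ // (∀ t, Q t.1 → μ t ≤ 1) ∧
        Finsupp.linearCombination ℕ (fun t => tquExponent t.1) μ = m}) :
    IsProdQuotient F (fun p : {p // Q p} => (1 + tqu p) ^ a p)
      (fun p : {p // Q' p} => (1 - tqu p) ^ a p) := by
  classical
  have hfin : ∀ (R : ℕ × ℕ → Prop) (m : Fin 3 →₀ ℕ),
      {p : {p // R p} | tquExponent p ≤ m}.Finite := fun R m =>
    Set.Finite.of_injOn (f := Subtype.val) (t := (Finset.Iic (m 1, m 2) : Set (ℕ × ℕ)))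
      (fun p hp => mem_of_tquExponent_le hp) Subtype.val_injective.injOn (Finset.finite_toSet _)
  have hnum : Multipliable fun p : {p // Q p} => (1 + tqu p) ^ a p := by
    refine multipliable_of_monomial_dvd (fun p : {p // Q p} => tquExponent p.1) (hfin Q) _
      fun p => ?_
    rw [← tqu_eq_monomial]
    simpa using sub_dvd_pow_sub_pow (1 + tqu p) 1 (a p)
  have hden : Multipliable fun p : {p // Q' p} => (1 - tqu p) ^ a p := by
    refine multipliable_of_monomial_dvd (fun p : {p // Q' p} => tquExponent p.1) (hfin Q') _
      fun p => ?_
    rw [← tqu_eq_monomial]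
    simpa using sub_dvd_pow_sub_pow (1 - tqu p) 1 (a p)
  refine ⟨hnum, hden, ?_, ?_⟩
  · have h := hden.hasProd.map (MvPowerSeries.constantCoeff (σ := Fin 3) (R := ℤ))
      (MvPowerSeries.WithPiTopology.continuous_constantCoeff ℤ)
    have h1 : ((MvPowerSeries.constantCoeff (σ := Fin 3) (R := ℤ)) ∘
        fun p : {p // Q' p} => (1 - tqu p) ^ a p) = fun _ => 1 := by
      funext p
      simp [tqu]
    rw [h1] at h
    rw [MvPowerSeries.isUnit_iff_constantCoeff, h.unique hasProd_one]
    exact isUnit_one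
  · -- The finite partial products satisfy the identity, and it passes to the limit.
    let G : Finset (ℕ × ℕ) → MvPowerSeries (Fin 3) ℤ := fun U =>
      ∏ p ∈ U, powerSum (Q p) (tquExponent p) ^ a p
    have hG : Filter.Tendsto G Filter.atTop (nhds F) := by
      rw [MvPowerSeries.WithPiTopology.tendsto_iff_coeff_tendsto]
      intro m
      refine tendsto_const_nhds.congr' ?_
      filter_upwards [Filter.eventually_ge_atTop (Finset.Iic (m 1, m 2))] with U hU
      have h := coeff_prod_powerSum (S := Σ p : ℕ × ℕ, Fin (a p)) (fun t => Q t.1)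
        (fun t => tquExponent t.1) (fun t => tquExponent_zero t.1) m
        (U.sigma fun p => (Finset.univ : Finset (Fin (a p))))
        (fun t ht => Finset.mem_sigma.mpr ⟨hU (mem_of_tquExponent_le ht), Finset.mem_univ _⟩)
      rw [hF, ← h, Finset.prod_sigma]
      simp [G]
    have hn : HasProd (Set.mulIndicator {p | Q p} fun p : ℕ × ℕ => (1 + tqu p) ^ a p)
        (∏' p : {p // Q p}, (1 + tqu p) ^ a p) :=
      hasProd_subtype_iff_mulIndicator.mp hnum.hasProd
    have hd : HasProd (Set.mulIndicator {p | Q' p} fun p : ℕ × ℕ => (1 - tqu p) ^ a p)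
        (∏' p : {p // Q' p}, (1 - tqu p) ^ a p) :=
      hasProd_subtype_iff_mulIndicator.mp hden.hasProd
    rw [HasProd, SummationFilter.unconditional_filter] at hn hd
    have hmul := hG.mul hd
    refine tendsto_nhds_unique (hmul.congr fun U => ?_) hn
    simp only [G]
    rw [← Finset.prod_mul_distrib]
    refine Finset.prod_congr rfl fun p _ => ?_
    by_cases hp : Q p
    · have hp' : p ∉ {p | Q' p} := fun h => (hQ p).mp h hp
      rw [Set.mulIndicator_of_notMem hp', Set.mulIndicator_of_mem (show p ∈ {p | Q p} from hp),
        mul_one, powerSum_of_exclusive hp (tquExponent_ne_zero p), tqu_eq_monomial]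
    · rw [Set.mulIndicator_of_mem (show p ∈ {p | Q' p} from (hQ p).mpr hp),
        Set.mulIndicator_of_notMem (show p ∉ {p | Q p} from hp), ← mul_pow, tqu_eq_monomial,
        powerSum_mul_one_sub hp (tquExponent_ne_zero p), one_pow]

end Products

/-! ### The generating function -/

section GeneratingFunction

/-- The generating function of the `χ`-relative invariants, for characters `χ` of the symmetric
groups such that `χ` and `(-1)ʲ` differ at transpositions exactly when `j` satisfies `Ex`. -/
theorem isProdQuotient_relInvariants {k : Type*} [Field k] [CharZero k]
    {H : Type*} [Group H] [Finite H]
    {V₀ V₁ : Type*} [AddCommGroup V₀] [Module k V₀] [AddCommGroup V₁] [Module k V₁]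
    [FiniteDimensional k V₀] [FiniteDimensional k V₁]
    (ρ₀ : Representation k H V₀) (ρ₁ : Representation k H V₁)
    (χ : ∀ n, Equiv.Perm (Fin n) →* kˣ) (Ex Ex' : ℕ → Prop) (hEx : ∀ j, Ex' j ↔ ¬ Ex j)
    (hχ : ∀ n x y, x ≠ y → ∀ j, (-1 : k) ^ j = (χ n (Equiv.swap x y) : k) ↔ ¬ Ex j) :
    IsProdQuotient (genFun fun n => hilb (relInvariants (wreathSuperSymRep n ρ₀ ρ₁)
        ((χ n).comp SemidirectProduct.rightHom)))
      (fun p : {p : ℕ × ℕ // Ex p.2} => (1 + tqu p) ^ invDim ρ₀ ρ₁ p)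
      (fun p : {p : ℕ × ℕ // Ex' p.2} => (1 - tqu p) ^ invDim ρ₀ ρ₁ p) := by
  have := Fintype.ofFinite H
  refine isProdQuotient_of_coeff (invDim ρ₀ ρ₁) (fun p => Ex p.2) (fun p => Ex' p.2)
    (fun p => hEx p.2) _ fun m => ?_
  have h := finrank_relInvariants_inf_piece ρ₀ ρ₁ m (χ (m 0)) Ex (hχ (m 0))
  rw [← h]
  change ((Module.finrank k ↥(_ ⊓ superSymPiece k _ _
    ((Finsupp.single 0 (m 1) + Finsupp.single 1 (m 2) : Fin 2 →₀ ℕ) 0)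
    ((Finsupp.single 0 (m 1) + Finsupp.single 1 (m 2) : Fin 2 →₀ ℕ) 1)) : ℕ) : ℤ) = _
  have e0 : (Finsupp.single 0 (m 1) + Finsupp.single 1 (m 2) : Fin 2 →₀ ℕ) 0 = m 1 := by simp
  have e1 : (Finsupp.single 0 (m 1) + Finsupp.single 1 (m 2) : Fin 2 →₀ ℕ) 1 = m 2 := by simp
  rw [e0, e1]

end GeneratingFunction

end SuperInv

theorem theorem1p2 {k V : Type*} [Field k] [CharZero k] [AddCommGroup V] [Module k V]
    [FiniteDimensional k V] (V₀ V₁ : Submodule k V) (hV : IsCompl V₀ V₁)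
    (G : Subgroup (LinearMap.GeneralLinearGroup k V)) [Finite G]
    (hG : SuperInv.PreservesGrading V₀ V₁ G) :
    SuperInv.IsProdQuotient
        (SuperInv.genFun fun n => SuperInv.hilb
          (SuperInv.wreathSuperSymRep n (SuperInv.evenRep hG) (SuperInv.oddRep hG)).invariants)
        (fun p : {p : ℕ × ℕ // Odd p.2} =>
          (1 + SuperInv.tqu p) ^ SuperInv.invDim (SuperInv.evenRep hG) (SuperInv.oddRep hG) p)
        (fun p : {p : ℕ × ℕ // Even p.2} =>
          (1 - SuperInv.tqu p) ^ SuperInv.invDim (SuperInv.evenRep hG) (SuperInv.oddRep hG) p) ∧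
      SuperInv.IsProdQuotient
        (SuperInv.genFun fun n => SuperInv.hilb (SuperInv.relInvariants
          (SuperInv.wreathSuperSymRep n (SuperInv.evenRep hG) (SuperInv.oddRep hG))
          (SuperInv.wreathSign k n G)))
        (fun p : {p : ℕ × ℕ // Even p.2} =>
          (1 + SuperInv.tqu p) ^ SuperInv.invDim (SuperInv.evenRep hG) (SuperInv.oddRep hG) p)
        (fun p : {p : ℕ × ℕ // Odd p.2} =>
          (1 - SuperInv.tqu p) ^ SuperInv.invDim (SuperInv.evenRep hG) (SuperInv.oddRep hG) p) := by
  have hne : (-1 : k) ≠ 1 := fun h => two_ne_zero (α := k) (by linear_combination -h)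
  constructor
  · have h := SuperInv.isProdQuotient_relInvariants (SuperInv.evenRep hG) (SuperInv.oddRep hG)
      (fun _ => 1) Odd Even (fun j => Nat.not_odd_iff_even.symm) (by
        intro n x y _ j
        rw [MonoidHom.one_apply, Units.val_one, Nat.not_odd_iff_even]
        exact neg_one_pow_eq_one_iff_even hne)
    convert h using 4 with n
    ext f
    simp [SuperInv.relInvariants, Representation.mem_invariants]
  · refine SuperInv.isProdQuotient_relInvariants (SuperInv.evenRep hG) (SuperInv.oddRep hG)
      (fun _ => (Units.map (Int.castRingHom k : ℤ →* k)).comp Equiv.Perm.sign) Even Odd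
      (fun j => Nat.not_even_iff_odd.symm) ?_
    intro n x y hxy j
    rw [MonoidHom.comp_apply, Equiv.Perm.sign_swap hxy]
    simp only [Units.coe_map, Units.val_neg, Units.val_one, MonoidHom.coe_coe, map_neg, map_one]
    rw [Nat.not_even_iff_odd]
    refine ⟨fun h => ?_, fun h => h.neg_one_pow⟩
    by_contra hj
    rw [Nat.not_odd_iff_even] at hj
    rw [hj.neg_one_pow] at h
    exact hne h.symm
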